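/- Fix $n\ge 3$ and $T\ge 2$, put $N=4n$ (so $N\ge 12$), and let $V=\mathbb Z_n\times\{0,1,01,11\}$, so $|V|=N$. For $x\in\{0,1\}^n$ (indices modulo $n$) let $G_A(x)$ be the directed graph on $V$ whose edges are, for every $i\in\mathbb Z_n$: $(i,1)\to(i+1,z)$ with $z=0$ if $x_{i+1}=0$ and $z=11$ otherwise; if $x_i=0$, $(i,0)\to(i+1,z)$ with $z=0$ if $x_{i+1}=0$ and $z=01$ otherwise; if $x_i=1$, $(i,0)\to(i-1,x_{i-1})$; and $(i,01)\to(i,1)$, $(i,11)\to(i,1)$. For $y\in\{0,1\}^n$ let $G_B(y)$ be the directed graph on $V$ whose edges are, for every $i$: $(i,1)\to(i+1,z)$ with $z=0$ if $y_{i+1}=0$ and $z=11$ otherwise; $(i,0)\to(i+1,z)$ with $z=0$ if $y_{i+1}=0$ and $z=01$ otherwise; and $(i,01)\to(i,1)$, $(i,11)\to(i,1)$. The Bayesian 2-cycle game on $N$ actions and $T$ types is built from two strings $x,y\in\{0,1\}^{Tn}$ for which there is exactly one index $i$ with $x_i>y_i$. Write $x=x^1\cdots x^T$ and $y=y^1\cdots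 y^T$ with blocks of $n$ bits. Both players have the action set $V$ and the type set $[T]$, and the prior is uniform over $\{(t,t):t\in[T]\}$. The utilities are $u_A(t,u,v)=1$ if $(v,u)$ is an edge of $G_A(x^t)$ and $0$ otherwise, and $u_B(t,u,v)=1$ if $(u,v)$ is an edge of $G_B(y^t)$ and $0$ otherwise. An $\varepsilon$-approximate Bayesian Nash equilibrium consists of probability distributions $a^*_t,b^*_t$ on $V$ for $t\in[T]$ such that no type of either player can increase its expected utility, conditioned on its own type, by more than $\varepsilon$ by changing its distribution. In the communication problem, $T$, $n$, $\varepsilon$ and the prior are known to both players, player $A$ is given the function $u_A$ and player $B$ the function $u_B$; at the end $A$ has to output $(a^*_t)_{t\in[T]}$ and $B$ has to output $(b^*_t)_{t\in[T]}$ such that together they form an $\varepsilon$-approximate Bayesian Nash equilibrium. **Theorem.** There is an absolute constant $c>0$ such that for all $N=4n\ge 12$, all $T\ge 2$ and every $\varepsilon\le\frac1{16N^2}$, every randomized (public- or private-coin) communication protocol that solves this problem with error probability at most $\frac13$ on every Bayesian 2-cycle game on $N$ actions and $T$ types has worst-case communication complexity at least $c\cdot N\cdot T$ bits. -/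

import Mathlib

open scoped ENNReal
open MeasureTheory

universe u

/-! ## Two-party communication protocols -/

/-- A deterministic two-party communication protocol as a tree. At an inner node one of the players
sends a single bit that depends only on that player's own input (and on the transcript so far, which
is the position in the tree). At a leaf each player computes an output from that player's own input
and the transcript. -/
inductive Protocol (X Y OA OB : Type) : Type where
  | leaf (outA : X → OA) (outB : Y → OB) : Protocol X Y OA OB
  | nodeA (bit : X → Bool) (next : Bool → Protocol X Y OA OB) : Protocol X Y OA OB
  | nodeB (bit : Y → Bool) (next : Bool → Protocol X Y OA OB) : Protocol X Y OA OB

namespace Protocol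

variable {X Y OA OB : Type}

/-- The outputs of the two players on the inputs `x` (of player `A`) and `y` (of player `B`). -/
def run : Protocol X Y OA OB → X → Y → OA × OB
  | leaf outA outB, x, y => (outA x, outB y)
  | nodeA bit next, x, y => (next (bit x)).run x y
  | nodeB bit next, x, y => (next (bit y)).run x y

/-- The number of bits communicated in the worst case, which is the depth of the tree. -/
def depth : Protocol X Y OA OB → ℕ
  | leaf _ _ => 0
  | nodeA _ next => max (next false).depth (next true).depth + 1
  | nodeB _ next => max (next false).depth (next true).depth + 1

end Protocol

/-- A randomized communication protocol: a deterministic protocol chosen by means of an outcome of an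
arbitrary probability space. All coins are visible to both players (public coins); protocols with
private coins are the special case in which the bits and outputs of each player depend only on that
player's part of the outcome. -/
structure RandomizedProtocol (X Y OA OB : Type) : Type (u + 1) where
  /-- the space of coin outcomes -/
  Coins : Type u
  [measurableSpace : MeasurableSpace Coins]
  /-- the distribution of the coins -/
  prob : Measure Coins
  [isProbabilityMeasure : IsProbabilityMeasure prob]
  /-- the protocol that is run for a given outcome of the coins -/
  protocol : Coins → Protocol X Y OA OB

namespace RandomizedProtocol

variable {X Y OA OB : Type}

/-- The protocol never communicates more than `C` bits: its communication complexity is at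
most `C`. -/
def CostAtMost (π : RandomizedProtocol.{u} X Y OA OB) (C : ℕ) : Prop :=
  ∀ ω, (π.protocol ω).depth ≤ C

/-- On every pair of inputs that satisfies the promise `valid`, the probability that the pair of
outputs does not satisfy the relation `R` is at most `δ`. (For a set that is not measurable, `prob`
is the outer measure, so no measurability is needed.) -/
def ErrorAtMost (π : RandomizedProtocol.{u} X Y OA OB) (valid : X → Y → Prop)
    (R : X → Y → OA → OB → Prop) (δ : ℝ≥0∞) : Prop :=
  ∀ x y, valid x y →
    letI := π.measurableSpace
    π.prob {ω | ¬ R x y ((π.protocol ω).run x y).1 ((π.protocol ω).run x y).2} ≤ δ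

end RandomizedProtocol

/-! ## Bayesian games -/

noncomputable section

/-- A mixed strategy over a finite set of actions: a probability vector. -/
abbrev MixedStrategy (S : Type) [Fintype S] : Type := stdSimplex ℝ S

section Bayesian

variable {ΘA ΘB SA SB : Type} [Fintype ΘA] [Fintype ΘB] [Fintype SA] [Fintype SB]

/-- The expected utility of player `A` of type `tA` when `A` plays the mixed strategy `a`, player `B`
of type `tB` plays `b tB`, and `tB` is drawn from the prior `φ` conditioned on `tA`. -/
def expectedUtilityA (φ : stdSimplex ℝ (ΘA × ΘB)) (uA : ΘA → SA → SB → unitInterval) (tA : ΘA)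
    (a : MixedStrategy SA) (b : ΘB → MixedStrategy SB) : ℝ :=
  ∑ tB, (φ (tA, tB) / ∑ t, φ (tA, t)) * ∑ u, ∑ v, a u * b tB v * (uA tA u v : ℝ)

/-- The expected utility of player `B` of type `tB` when `B` plays the mixed strategy `b`, player `A`
of type `tA` plays `a tA`, and `tA` is drawn from the prior `φ` conditioned on `tB`. -/
def expectedUtilityB (φ : stdSimplex ℝ (ΘA × ΘB)) (uB : ΘB → SA → SB → unitInterval) (tB : ΘB)
    (a : ΘA → MixedStrategy SA) (b : MixedStrategy SB) : ℝ :=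
  ∑ tA, (φ (tA, tB) / ∑ t, φ (t, tB)) * ∑ u, ∑ v, a tA u * b v * (uB tB u v : ℝ)

/-- `ε`-approximate Bayesian Nash equilibrium of the Bayesian game with prior `φ` and utility
functions `uA`, `uB`. -/
def IsApproxBayesianNash (ε : ℝ) (φ : stdSimplex ℝ (ΘA × ΘB))
    (uA : ΘA → SA → SB → unitInterval) (uB : ΘB → SA → SB → unitInterval)
    (a : ΘA → MixedStrategy SA) (b : ΘB → MixedStrategy SB) : Prop :=
  (∀ (tA : ΘA) (a' : MixedStrategy SA),
    expectedUtilityA φ uA tA a' b - expectedUtilityA φ uA tA (a tA) b ≤ ε) ∧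
  (∀ (tB : ΘB) (b' : MixedStrategy SB),
    expectedUtilityB φ uB tB a b' - expectedUtilityB φ uB tB a (b tB) ≤ ε)

end Bayesian

/-! ## The 2-cycle game -/

/-- The four labels `0, 1, 01, 11`. -/
inductive Label : Type where
  | l0 | l1 | l01 | l11
  deriving DecidableEq

instance : Fintype Label where
  elems := {.l0, .l1, .l01, .l11}
  complete := by intro z; cases z <;> decide

/-- The vertices `[n] × {0, 1, 01, 11}`, with `[n]` the integers modulo `n`. -/
abbrev Vertex (n : ℕ) : Type := Fin n × Label

/-- The label `0` or `1` of a bit. -/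
def bitLabel (c : Bool) : Label := if c then .l1 else .l0

/-- The edges of the graph of player `A` (`EdgeA x u v` is a directed edge from `u` to `v`). -/
inductive EdgeA {n : ℕ} [NeZero n] (x : Fin n → Bool) : Vertex n → Vertex n → Prop where
  | one (i : Fin n) : EdgeA x (i, .l1) (i + 1, if x (i + 1) then .l11 else .l0)
  | zero (i : Fin n) (h : x i = false) : EdgeA x (i, .l0) (i + 1, if x (i + 1) then .l01 else .l0)
  | back (i : Fin n) (h : x i = true) : EdgeA x (i, .l0) (i - 1, bitLabel (x (i - 1)))
  | mid01 (i : Fin n) : EdgeA x (i, .l01) (i, .l1)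
  | mid11 (i : Fin n) : EdgeA x (i, .l11) (i, .l1)

/-- The edges of the graph of player `B`. -/
inductive EdgeB {n : ℕ} [NeZero n] (y : Fin n → Bool) : Vertex n → Vertex n → Prop where
  | one (i : Fin n) : EdgeB y (i, .l1) (i + 1, if y (i + 1) then .l11 else .l0)
  | zero (i : Fin n) : EdgeB y (i, .l0) (i + 1, if y (i + 1) then .l01 else .l0)
  | mid01 (i : Fin n) : EdgeB y (i, .l01) (i, .l1)
  | mid11 (i : Fin n) : EdgeB y (i, .l11) (i, .l1)

open Classical in
/-- The utility function of player `A` in the 2-cycle game. -/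
def twoCycleUtilityA {n : ℕ} [NeZero n] (x : Fin n → Bool) (u v : Vertex n) : unitInterval :=
  if EdgeA x v u then 1 else 0

open Classical in
/-- The utility function of player `B` in the 2-cycle game. -/
def twoCycleUtilityB {n : ℕ} [NeZero n] (y : Fin n → Bool) (u v : Vertex n) : unitInterval :=
  if EdgeB y u v then 1 else 0

/-! ## The Bayesian 2-cycle game -/

/-- The `i`-th block of `n` bits of a string of `T * n` bits (bit `j` of it is bit `n * i + j` of the
whole string, counting from zero). -/
def block {T n : ℕ} (x : Fin (T * n) → Bool) (i : Fin T) (j : Fin n) : Bool :=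
  x (finProdFinEquiv (i, j))

/-- The utility function of player `A` in the Bayesian 2-cycle game. -/
def bayesianTwoCycleUtilityA {T n : ℕ} [NeZero n] (x : Fin (T * n) → Bool) :
    Fin T → Vertex n → Vertex n → unitInterval :=
  fun i => twoCycleUtilityA (block x i)

/-- The utility function of player `B` in the Bayesian 2-cycle game. -/
def bayesianTwoCycleUtilityB {T n : ℕ} [NeZero n] (y : Fin (T * n) → Bool) :
    Fin T → Vertex n → Vertex n → unitInterval :=
  fun i => twoCycleUtilityB (block y i)

/-- The prior: the uniform distribution over the pairs `(i, i)` of types. -/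
def diagonalPrior (T : ℕ) [NeZero T] : stdSimplex ℝ (Fin T × Fin T) :=
  ⟨fun p => if p.1 = p.2 then 1 / (T : ℝ) else 0, by
    constructor
    · intro p
      dsimp only
      split_ifs <;> positivity
    · simp [Fintype.sum_prod_type, NeZero.ne T]⟩

/-- The pairs of utility functions of a Bayesian 2-cycle game with `T` types and `4 * n` actions:
those built from two strings `x, y` of `T * n` bits with exactly one index `i` with `x i > y i`
(where `false < true`). -/
def IsBayesianTwoCycle (T n : ℕ) [NeZero n]
    (uA uB : Fin T → Vertex n → Vertex n → unitInterval) : Prop :=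
  ∃ x y : Fin (T * n) → Bool, (∃! i, x i > y i) ∧
    uA = bayesianTwoCycleUtilityA x ∧ uB = bayesianTwoCycleUtilityB y

/-- The protocol `π` finds an `ε`-approximate Bayesian Nash equilibrium of the Bayesian 2-cycle game
with error probability at most `δ`: given the utility functions, player `A` outputs the strategies
of `A` and player `B` outputs the strategies of `B`, one for each type. -/
def FindsApproxBayesianNash (T n : ℕ) [NeZero T] [NeZero n] (ε : ℝ) (δ : ℝ≥0∞)
    (π : RandomizedProtocol.{u} (Fin T → Vertex n → Vertex n → unitInterval)
      (Fin T → Vertex n → Vertex n → unitInterval)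
      (Fin T → MixedStrategy (Vertex n)) (Fin T → MixedStrategy (Vertex n))) : Prop :=
  π.ErrorAtMost (IsBayesianTwoCycle T n)
    (fun uA uB a b => IsApproxBayesianNash ε (diagonalPrior T) uA uB a b) δ

end

/-! The source of hardness is a search problem: find the common element of two sets `S`, `S'` that
meet in exactly one point. `S` is written as the ones of `x` and `S'` as the zeros of `y`, both at
the odd positions of the blocks; the even positions are padded with `x = 0`, `y = 1`. Then `x > y`
holds exactly at the common element.

Equilibria reveal this element. The prior is diagonal and every vertex has one out-neighbour, so
each type plays a separate game of near-best responses to two maps `stepA`, `stepB`. An action of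
mass at least `1 / (4N)` needs a preimage of at least that mass in the opponent's strategy
(`exists_preimage`), so the two maps act as bijections between the players' sets of heavy actions.
In the block with `x i > y i` there is the 2-cycle through `(i - 1, 0)` and `(i, 0)`. Heavy actions
off this cycle would have to appear at every index of the ring, and the padding at `i - 1` forbids
that; hence `A` puts mass at least `3/4` on `(i - 1, 0)`. Conversely, in any block, mass `3/4` on
some `(j, 0)` forces a 2-cycle and so `x > y` at `j + 1`. The output of `A` alone therefore names
the element.

The search problem is hard by Razborov's corruption argument. The pairs on which a deterministic
protocol of depth `C` fails form at most `2 ^ C * (m + 1)` disjoint rectangles, where `m` is the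
size of the ground set, and they include all disjoint pairs. By `corruption_bound`, covering the
disjoint pairs by few rectangles forces a constant fraction of the uniquely intersecting weight into
them. Averaging over the coins makes the failure weight small, so `C` must be linear in `m`, and
here `m` is at least `n * T / 3`. -/

/-! ### Biased coordinates in families of sets. -/

section SetCounts

variable {V : Type*} [DecidableEq V]

/-- The number of members of `X` that are contained in `Z`. -/
noncomputable def countSubsets (X : Finset (Finset V)) (Z : Finset V) : ℝ :=
  ((X.filter (· ⊆ Z)).card : ℝ)

/-- The number of members of `X` that contain `i` and are contained in `insert i Z`. -/
noncomputable def countThrough (X : Finset (Finset V)) (i : V) (Z : Finset V) : ℝ :=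
  ((X.filter (fun x => i ∈ x ∧ x ⊆ insert i Z)).card : ℝ)

theorem countSubsets_nonneg (X : Finset (Finset V)) (Z : Finset V) : 0 ≤ countSubsets X Z :=
  Nat.cast_nonneg _

theorem countThrough_nonneg (X : Finset (Finset V)) (i : V) (Z : Finset V) :
    0 ≤ countThrough X i Z :=
  Nat.cast_nonneg _

theorem countSubsets_le (X : Finset (Finset V)) (Z : Finset V) :
    countSubsets X Z ≤ 2 ^ Z.card := by
  unfold countSubsets
  have : X.filter (· ⊆ Z) ⊆ Z.powerset := by
    intro x hx
    simpa using (Finset.mem_filter.1 hx).2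
  have h := Finset.card_le_card this
  rw [Finset.card_powerset] at h
  exact_mod_cast h

theorem countSubsets_eq_add (X : Finset (Finset V)) {U : Finset V} {i : V} (hi : i ∈ U) :
    countSubsets X U = countSubsets X (U.erase i) + countThrough X i (U.erase i) := by
  unfold countSubsets countThrough
  rw [Finset.insert_erase hi, ← Nat.cast_add,
    ← Finset.card_filter_add_card_filter_not (s := X.filter (· ⊆ U)) (fun x => i ∉ x),
    Finset.filter_filter, Finset.filter_filter]
  congr 3
  · congr 1
    ext x
    rw [Finset.subset_erase]
  · congr 1
    ext x
    simp [and_comm]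

/-- Hoeffding's estimate for one fair bit with values `1/4` and `-3/4`: factor out the mean `-1/4`
and use `cosh t ≤ exp (t ^ 2 / 2)` at `t = 1/2`. -/
theorem exp_quarter_add_exp_le :
    Real.exp (1 / 4) + Real.exp (-3 / 4) ≤ 2 * Real.exp (-1 / 8) := by
  have h := Real.cosh_le_exp_half_sq (1 / 2)
  rw [Real.cosh_eq] at h
  have h1 : Real.exp (1 / 4) = Real.exp (1 / 2) * Real.exp (-1 / 4) := by
    rw [← Real.exp_add]; norm_num
  have h2 : Real.exp (-3 / 4) = Real.exp (-(1 / 2)) * Real.exp (-1 / 4) := by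
    rw [← Real.exp_add]; norm_num
  have h3 : Real.exp (-1 / 8) = Real.exp ((1 / 2) ^ 2 / 2) * Real.exp (-1 / 4) := by
    rw [← Real.exp_add]; norm_num
  rw [h1, h2, h3, ← add_mul]
  nlinarith [Real.exp_pos (-1 / 4 : ℝ)]

/-- A family of subsets of `U` for which many coordinates have a biased membership is small. -/
theorem countSubsets_le_of_biased (X : Finset (Finset V)) {U K : Finset V} (hK : K ⊆ U)
    (s : V → Prop) [DecidablePred s]
    (h : ∀ i ∈ K, 3 / 4 * countSubsets X U ≤
      (((X.filter (· ⊆ U)).filter (fun x => i ∈ x ↔ s i)).card : ℝ)) :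
    countSubsets X U ≤ 2 ^ U.card * Real.exp (-(K.card : ℝ) / 8) := by
  classical
  set X' := X.filter (· ⊆ U) with hX'
  -- Exponential moments replace entropy. The weights `1/4` and `-3/4` make the total score
  -- nonnegative under 3/4 agreement, so `exp` of the score sums to at least the number of sets;
  -- over the whole powerset that sum factors over coordinates.
  set e : Finset V → ℝ := fun x => ∑ i ∈ K, if (i ∈ x ↔ s i) then (1 / 4 : ℝ) else -3 / 4 with he
  have hsum : 0 ≤ ∑ x ∈ X', e x := by
    rw [he, Finset.sum_comm]
    refine Finset.sum_nonneg fun i hi => ?_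
    have h1 : ∀ x ∈ X', (if (i ∈ x ↔ s i) then (1 / 4 : ℝ) else -3 / 4) =
        (if (i ∈ x ↔ s i) then (1 : ℝ) else 0) - 3 / 4 := by
      intro x _; split_ifs <;> norm_num
    rw [Finset.sum_congr rfl h1, Finset.sum_sub_distrib, Finset.sum_boole, Finset.sum_const,
      nsmul_eq_mul]
    have := h i hi
    unfold countSubsets at this
    linarith
  have hle : countSubsets X U ≤ ∑ x ∈ X', Real.exp (e x) := by
    have : ∑ x ∈ X', (e x + 1) ≤ ∑ x ∈ X', Real.exp (e x) :=
      Finset.sum_le_sum fun x _ => Real.add_one_le_exp _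
    rw [Finset.sum_add_distrib, Finset.sum_const, nsmul_eq_mul, mul_one] at this
    unfold countSubsets
    linarith
  have hle2 : ∑ x ∈ X', Real.exp (e x) ≤ ∑ x ∈ U.powerset, Real.exp (e x) := by
    refine Finset.sum_le_sum_of_subset_of_nonneg ?_ fun _ _ _ => (Real.exp_pos _).le
    intro x hx
    simpa using (Finset.mem_filter.1 hx).2
  set p : V → ℝ := fun i => if i ∈ K then (if s i then Real.exp (1 / 4) else Real.exp (-3 / 4))
    else 1 with hp
  set q : V → ℝ := fun i => if i ∈ K then (if s i then Real.exp (-3 / 4) else Real.exp (1 / 4))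
    else 1 with hq
  have hexp : ∀ x ∈ U.powerset, Real.exp (e x) = (∏ i ∈ x, p i) * ∏ i ∈ U \ x, q i := by
    intro x hx
    have hx := Finset.mem_powerset.1 hx
    have h1 : ∏ i ∈ x, p i = ∏ i ∈ x, (if i ∈ x then p i else q i) :=
      Finset.prod_congr rfl fun i hi => by simp [hi]
    have h2 : ∏ i ∈ U \ x, q i = ∏ i ∈ U \ x, (if i ∈ x then p i else q i) :=
      Finset.prod_congr rfl fun i hi => by simp [(Finset.mem_sdiff.1 hi).2]
    rw [h1, h2, mul_comm, Finset.prod_sdiff hx, he, Real.exp_sum, ← Finset.prod_subset hK]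
    · refine Finset.prod_congr rfl fun i hi => ?_
      simp only [hp, hq, hi, if_true]
      by_cases h3 : i ∈ x <;> by_cases h4 : s i <;> simp [h3, h4]
    · intro i _ hi
      simp [hp, hq, hi]
  have hprod : ∑ x ∈ U.powerset, Real.exp (e x) = ∏ i ∈ U, (p i + q i) := by
    rw [Finset.prod_add, Finset.sum_congr rfl hexp]
  have hpq : ∏ i ∈ U, (p i + q i) ≤ ∏ i ∈ U, (2 * if i ∈ K then Real.exp (-1 / 8) else 1) := by
    refine Finset.prod_le_prod (fun i _ => ?_) fun i _ => ?_
    · simp only [hp, hq]; split_ifs <;> positivity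
    · have := exp_quarter_add_exp_le
      simp only [hp, hq]
      split_ifs <;> linarith
  have hfin : ∏ i ∈ U, (2 * if i ∈ K then Real.exp (-1 / 8) else (1 : ℝ)) =
      2 ^ U.card * Real.exp (-(K.card : ℝ) / 8) := by
    rw [Finset.prod_mul_distrib, Finset.prod_const, Finset.prod_ite_mem,
      Finset.inter_eq_right.2 hK, Finset.prod_const, ← Real.exp_nat_mul]
    congr 2
    ring
  linarith

/-- Among the members of `X` inside `U`, only few coordinates are much less often present than
absent, unless there are few such members. -/
theorem sum_countSubsets_erase_biased_le (X : Finset (Finset V)) (U : Finset V) :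
    (∑ i ∈ U, if 3 * countThrough X i (U.erase i) < countSubsets X (U.erase i)
      then countSubsets X (U.erase i) else 0) ≤
    1 / 4 * ∑ i ∈ U, countSubsets X (U.erase i) +
      U.card * (2 ^ U.card * Real.exp (-(U.card : ℝ) / 160)) := by
  classical
  set n0 : V → ℝ := fun i => countSubsets X (U.erase i) with hn0
  set n1 : V → ℝ := fun i => countThrough X i (U.erase i) with hn1
  set N := countSubsets X U with hN
  have hadd : ∀ i ∈ U, N = n0 i + n1 i := fun i hi => countSubsets_eq_add X hi
  have h0 : ∀ i, 0 ≤ n0 i := fun i => countSubsets_nonneg _ _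
  have h1 : ∀ i, 0 ≤ n1 i := fun i => countThrough_nonneg _ _ _
  have hNn : 0 ≤ N := countSubsets_nonneg _ _
  -- Both directions of bias are collected: the first carries the sum to be bounded, and excluding
  -- the second gives `n0 i ≥ N / 4` off `K`.
  set K := U.filter (fun i => 3 * n1 i < n0 i ∨ 3 * n0 i < n1 i) with hK
  have hKU : K ⊆ U := Finset.filter_subset _ _
  have hNK : N ≤ 2 ^ U.card * Real.exp (-(K.card : ℝ) / 8) := by
    refine countSubsets_le_of_biased X hKU (fun i => 3 * n0 i < n1 i) fun i hi => ?_
    have hiU := hKU hi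
    have ha := hadd i hiU
    rcases (Finset.mem_filter.1 hi).2 with hb | hb
    · have hs : ¬ 3 * n0 i < n1 i := by have := h0 i; have := h1 i; intro; linarith
      have : (((X.filter (· ⊆ U)).filter (fun x => i ∈ x ↔ 3 * n0 i < n1 i)).card : ℝ) = n0 i := by
        change _ = ((X.filter (· ⊆ U.erase i)).card : ℝ)
        rw [Finset.filter_filter]
        congr 2
        ext x
        rw [Finset.mem_filter, Finset.mem_filter, Finset.subset_erase]
        tauto
      rw [this]
      change 3 / 4 * N ≤ _
      linarith
    · have : (((X.filter (· ⊆ U)).filter (fun x => i ∈ x ↔ 3 * n0 i < n1 i)).card : ℝ) = n1 i := by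
        change _ = ((X.filter (fun x => i ∈ x ∧ x ⊆ insert i (U.erase i))).card : ℝ)
        rw [Finset.filter_filter, Finset.insert_erase hiU]
        congr 2
        ext x
        rw [Finset.mem_filter, Finset.mem_filter]
        tauto
      rw [this]
      change 3 / 4 * N ≤ _
      linarith
  have hbad : (∑ i ∈ U, if 3 * n1 i < n0 i then n0 i else 0) ≤ K.card * N := by
    rw [← nsmul_eq_mul, ← Finset.sum_const, ← Finset.sum_subset hKU]
    · refine Finset.sum_le_sum fun i hi => ?_
      have := hadd i (hKU hi)
      have := h1 i
      split_ifs <;> linarith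
    · intro i hi hiK
      rw [if_neg]
      intro hlt
      exact hiK (Finset.mem_filter.2 ⟨hi, Or.inl hlt⟩)
  have hKc : (K.card : ℝ) ≤ U.card := by exact_mod_cast Finset.card_le_card hKU
  have hsum0 : 0 ≤ ∑ i ∈ U, n0 i := Finset.sum_nonneg fun i _ => h0 i
  -- With few biased coordinates the bad sum is at most `|U| N / 20`, below a quarter of `(19/20)
  -- |U| N / 4`. With many, the family is small; the exponent `160` is `8 * 20`.
  by_cases hk : (K.card : ℝ) ≤ U.card / 20
  · have hgood : (U.card - K.card : ℝ) * (N / 4) ≤ ∑ i ∈ U, n0 i := by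
      calc (U.card - K.card : ℝ) * (N / 4) = ∑ i ∈ U \ K, N / 4 := by
            rw [Finset.sum_const, nsmul_eq_mul, Finset.card_sdiff_of_subset hKU,
              Nat.cast_sub (Finset.card_le_card hKU)]
        _ ≤ ∑ i ∈ U \ K, n0 i := by
            refine Finset.sum_le_sum fun i hi => ?_
            obtain ⟨hiU, hiK⟩ := Finset.mem_sdiff.1 hi
            have := hadd i hiU
            by_contra hlt
            exact hiK (Finset.mem_filter.2 ⟨hiU, Or.inr (by linarith)⟩)
        _ ≤ ∑ i ∈ U, n0 i :=
            Finset.sum_le_sum_of_subset_of_nonneg Finset.sdiff_subset fun i _ _ => h0 i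
    have : 0 ≤ (U.card : ℝ) * (2 ^ U.card * Real.exp (-(U.card : ℝ) / 160)) := by positivity
    have h5 : (K.card : ℝ) * N ≤ U.card / 20 * N := mul_le_mul_of_nonneg_right hk hNn
    have h6 : (U.card : ℝ) * 19 / 20 * (N / 4) ≤ (U.card - K.card : ℝ) * (N / 4) :=
      mul_le_mul_of_nonneg_right (by linarith) (by linarith)
    have h7 : 0 ≤ (U.card : ℝ) * N := by positivity
    linarith
  · have h5 : (K.card : ℝ) * N ≤ U.card * N := mul_le_mul_of_nonneg_right hKc hNn
    have h6 : N ≤ 2 ^ U.card * Real.exp (-(U.card : ℝ) / 160) := by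
      refine hNK.trans (mul_le_mul_of_nonneg_left (Real.exp_le_exp.2 ?_) (by positivity))
      linarith
    have h7 := mul_le_mul_of_nonneg_left h6 (Nat.cast_nonneg (α := ℝ) U.card)
    linarith

end SetCounts

/-! ### Rectangles and the corruption bound. -/

/-- The relation `F` is the disjoint union of at most `K` rectangles. -/
def IsRectanglePartition {X Y : Type*} (F : X → Y → Prop) (K : ℕ) : Prop :=
  ∃ (ι : Type) (_ : Fintype ι) (A : ι → X → Prop) (B : ι → Y → Prop), Fintype.card ι ≤ K ∧
    (∀ x y, F x y ↔ ∃ l, A l x ∧ B l y) ∧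
    ∀ x y l l', A l x → B l y → A l' x → B l' y → l = l'

theorem IsRectanglePartition.and {X Y : Type*} {F G : X → Y → Prop} {K L : ℕ}
    (hF : IsRectanglePartition F K) (hG : IsRectanglePartition G L) :
    IsRectanglePartition (fun x y => F x y ∧ G x y) (K * L) := by
  obtain ⟨ι, _, A, B, hι, hAB, hu⟩ := hF
  obtain ⟨κ, _, A', B', hκ, hAB', hu'⟩ := hG
  refine ⟨ι × κ, inferInstance, fun l x => A l.1 x ∧ A' l.2 x, fun l y => B l.1 y ∧ B' l.2 y,
    ?_, ?_, ?_⟩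
  · rw [Fintype.card_prod]
    exact Nat.mul_le_mul hι hκ
  · intro x y
    change F x y ∧ G x y ↔ _
    rw [hAB, hAB']
    constructor
    · rintro ⟨⟨l, h1, h2⟩, l', h3, h4⟩
      exact ⟨(l, l'), ⟨h1, h3⟩, h2, h4⟩
    · rintro ⟨⟨l, l'⟩, ⟨h1, h3⟩, h2, h4⟩
      exact ⟨⟨l, h1, h2⟩, l', h3, h4⟩
  · rintro x y ⟨l, m⟩ ⟨l', m'⟩ h1 h2 h3 h4
    exact Prod.ext (hu x y _ _ h1.1 h2.1 h3.1 h4.1) (hu' x y _ _ h1.2 h2.2 h3.2 h4.2)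

section Corruption

variable {V : Type*} [DecidableEq V] [Fintype V]

/-- Exchanging the parts `U.erase i` and `Uᶜ` of a partition of the complement of `{i}`. -/
theorem sum_erase_compl_comm (F : V → Finset V → Finset V → ℝ) :
    ∑ U : Finset V, ∑ i ∈ U, F i (U.erase i) Uᶜ = ∑ U : Finset V, ∑ i ∈ U, F i Uᶜ (U.erase i) := by
  have hc : ∀ G : Finset V → V → ℝ, ∑ U : Finset V, ∑ i ∈ U, G U i =
      ∑ i, ∑ U ∈ Finset.univ.filter (fun U : Finset V => i ∈ U), G U i := fun G =>
    Finset.sum_comm' (by simp)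
  rw [hc, hc]
  refine Finset.sum_congr rfl fun i _ => ?_
  have h1 : ∀ U : Finset V, i ∈ U → insert i (insert i Uᶜ)ᶜ = U := by
    intro U hU
    rw [Finset.compl_insert, compl_compl, Finset.insert_erase hU]
  refine Finset.sum_nbij' (fun U => insert i Uᶜ) (fun U => insert i Uᶜ) ?_ ?_ ?_ ?_ ?_
  · intro U _; simp
  · intro U _; simp
  · intro U hU; exact h1 U (by simpa using hU)
  · intro U hU; exact h1 U (by simpa using hU)
  · intro U hU
    have hU : i ∈ U := by simpa using hU
    rw [Finset.compl_insert, compl_compl, Finset.erase_insert (by simpa using hU)]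

/-- The exponentially small error term of the corruption bound. -/
noncomputable def corruptionError (m : ℕ) : ℝ :=
  m * (2 ^ m * (1 + Real.exp (-1 / 160)) ^ m)

theorem sum_biased_le (X Y : Finset (Finset V)) :
    (∑ U : Finset V, ∑ i ∈ U, (if 3 * countThrough X i (U.erase i) < countSubsets X (U.erase i)
      then countSubsets X (U.erase i) else 0) * countSubsets Y Uᶜ) ≤
    1 / 4 * ∑ U : Finset V, ∑ i ∈ U, countSubsets X (U.erase i) * countSubsets Y Uᶜ +
      corruptionError (Fintype.card V) := by
  have hpt : ∀ U : Finset V,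
      (∑ i ∈ U, (if 3 * countThrough X i (U.erase i) < countSubsets X (U.erase i)
        then countSubsets X (U.erase i) else 0) * countSubsets Y Uᶜ) ≤
      1 / 4 * ∑ i ∈ U, countSubsets X (U.erase i) * countSubsets Y Uᶜ +
        Fintype.card V * (2 ^ Fintype.card V * Real.exp (-1 / 160) ^ U.card) := by
    intro U
    have h1 := mul_le_mul_of_nonneg_right (sum_countSubsets_erase_biased_le X U)
      (countSubsets_nonneg Y Uᶜ)
    rw [← Finset.sum_mul, ← Finset.sum_mul]
    refine h1.trans ?_
    rw [add_mul, mul_assoc]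
    refine add_le_add le_rfl ?_
    have hexp : Real.exp (-(U.card : ℝ) / 160) = Real.exp (-1 / 160) ^ U.card := by
      rw [← Real.exp_nat_mul]; congr 1; ring
    have hpow : (2 : ℝ) ^ Fintype.card V = 2 ^ U.card * 2 ^ Uᶜ.card := by
      rw [← pow_add, Finset.card_add_card_compl]
    rw [hexp, hpow]
    calc (U.card : ℝ) * (2 ^ U.card * Real.exp (-1 / 160) ^ U.card) * countSubsets Y Uᶜ
        ≤ (Fintype.card V : ℝ) * (2 ^ U.card * Real.exp (-1 / 160) ^ U.card) * 2 ^ Uᶜ.card := by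
          refine mul_le_mul (mul_le_mul_of_nonneg_right ?_ (by positivity))
            (countSubsets_le Y Uᶜ) (countSubsets_nonneg _ _) (by positivity)
          exact_mod_cast Finset.card_le_univ U
      _ = _ := by ring
  refine (Finset.sum_le_sum fun U _ => hpt U).trans ?_
  rw [Finset.sum_add_distrib, ← Finset.mul_sum, ← Finset.mul_sum, ← Finset.mul_sum]
  refine add_le_add le_rfl (le_of_eq ?_)
  unfold corruptionError
  congr 2
  have h := Fintype.sum_pow_mul_eq_add_pow V (Real.exp (-1 / 160)) (1 : ℝ)
  simp only [one_pow, mul_one] at h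
  rw [h, add_comm]

/-- Razborov's corruption bound for set disjointness: a rectangle with many disjoint pairs has many
pairs that intersect in one element. -/
theorem corruption_bound (X Y : Finset (Finset V)) :
    (∑ U : Finset V, ∑ i ∈ U, countSubsets X (U.erase i) * countSubsets Y Uᶜ) ≤
    1 / 2 * (∑ U : Finset V, ∑ i ∈ U, countSubsets X (U.erase i) * countSubsets Y Uᶜ) +
    9 * (∑ U : Finset V, ∑ i ∈ U, countThrough X i (U.erase i) * countThrough Y i Uᶜ) +
    2 * corruptionError (Fintype.card V) := by
  -- Each player's biased terms cost a quarter of the disjoint weight. Where neither is biased, both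
  -- `through` counts are at least a third of the `subsets` counts, hence the factor `9`.
  have hX := sum_biased_le X Y
  have hY := sum_biased_le Y X
  rw [sum_erase_compl_comm (fun i Z W => (if 3 * countThrough Y i Z < countSubsets Y Z
      then countSubsets Y Z else 0) * countSubsets X W),
    sum_erase_compl_comm (fun i Z W => countSubsets Y Z * countSubsets X W)] at hY
  have hcomm : ∑ U : Finset V, ∑ i ∈ U, countSubsets Y Uᶜ * countSubsets X (U.erase i) =
      ∑ U : Finset V, ∑ i ∈ U, countSubsets X (U.erase i) * countSubsets Y Uᶜ := by
    simp only [mul_comm]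
  rw [hcomm] at hY
  have hpt : (∑ U : Finset V, ∑ i ∈ U, countSubsets X (U.erase i) * countSubsets Y Uᶜ) ≤
      (∑ U : Finset V, ∑ i ∈ U, (if 3 * countThrough X i (U.erase i) < countSubsets X (U.erase i)
        then countSubsets X (U.erase i) else 0) * countSubsets Y Uᶜ) +
      (∑ U : Finset V, ∑ i ∈ U, (if 3 * countThrough Y i Uᶜ < countSubsets Y Uᶜ
        then countSubsets Y Uᶜ else 0) * countSubsets X (U.erase i)) +
      9 * (∑ U : Finset V, ∑ i ∈ U, countThrough X i (U.erase i) * countThrough Y i Uᶜ) := by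
    simp only [Finset.mul_sum, ← Finset.sum_add_distrib]
    refine Finset.sum_le_sum fun U _ => Finset.sum_le_sum fun i _ => ?_
    have h1 := countSubsets_nonneg X (U.erase i)
    have h2 := countSubsets_nonneg Y Uᶜ
    have h3 := countThrough_nonneg X i (U.erase i)
    have h4 := countThrough_nonneg Y i Uᶜ
    have h5 := mul_nonneg h1 h2
    have h6 := mul_nonneg h3 h4
    split_ifs with hx hy hy
    · nlinarith
    · nlinarith
    · nlinarith
    · have := mul_le_mul (not_lt.1 hx) (not_lt.1 hy) h2 (by positivity)
      nlinarith
  linarith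

open Classical in
/-- The weight of `(x, y)` in the distribution on disjoint pairs. -/
noncomputable def disjointWeight (x y : Finset V) : ℝ :=
  ∑ U : Finset V, ∑ i ∈ U, if x ⊆ U.erase i ∧ y ⊆ Uᶜ then 1 else 0

open Classical in
/-- The weight of `(x, y)` in the distribution on pairs that intersect in one element. -/
noncomputable def intersectingWeight (x y : Finset V) : ℝ :=
  ∑ U : Finset V, ∑ i ∈ U,
    if (i ∈ x ∧ x ⊆ insert i (U.erase i)) ∧ (i ∈ y ∧ y ⊆ insert i Uᶜ) then 1 else 0

theorem sum_sum_rectangle {W : Type*} [Fintype W] (S R A B : Finset W → Prop) [DecidablePred S] [DecidablePred R]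
    [DecidablePred A] [DecidablePred B] :
    (∑ x : Finset W, ∑ y : Finset W, if A x ∧ B y then (if S x ∧ R y then (1 : ℝ) else 0) else 0) =
    (((Finset.univ.filter A).filter S).card : ℝ) * (((Finset.univ.filter B).filter R).card : ℝ) := by
  rw [Finset.filter_filter, Finset.filter_filter, ← Finset.sum_boole, ← Finset.sum_boole,
    Finset.sum_mul_sum]
  refine Finset.sum_congr rfl fun x _ => Finset.sum_congr rfl fun y _ => ?_
  by_cases h1 : A x <;> by_cases h2 : B y <;> by_cases h3 : S x <;> by_cases h4 : R y <;>
    simp [h1, h2, h3, h4]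

theorem sum_if_sum_flags {W : Type*} [Fintype W]
    (P : Finset W → Finset W → Prop) [∀ x y, Decidable (P x y)]
    (Q : Finset W → W → Finset W → Finset W → Prop) [∀ U i x y, Decidable (Q U i x y)] :
    (∑ x : Finset W, ∑ y : Finset W, if P x y then
      (∑ U : Finset W, ∑ i ∈ U, if Q U i x y then (1 : ℝ) else 0) else 0) =
    ∑ U : Finset W, ∑ i ∈ U, ∑ x : Finset W, ∑ y : Finset W,
      if P x y then (if Q U i x y then (1 : ℝ) else 0) else 0 := by
  have h1 : ∀ x y : Finset W, (if P x y then
      (∑ U : Finset W, ∑ i ∈ U, if Q U i x y then (1 : ℝ) else 0) else 0) =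
      ∑ U : Finset W, ∑ i ∈ U, if P x y then (if Q U i x y then (1 : ℝ) else 0) else 0 := by
    intro x y
    split_ifs <;> simp
  simp only [h1]
  rw [Finset.sum_congr rfl fun x _ => Finset.sum_comm, Finset.sum_comm]
  refine Finset.sum_congr rfl fun U _ => ?_
  rw [Finset.sum_congr rfl fun x _ => Finset.sum_comm, Finset.sum_comm]

open Classical in
theorem sum_disjointWeight_rectangle (A B : Finset V → Prop) :
    (∑ x : Finset V, ∑ y : Finset V, if A x ∧ B y then disjointWeight x y else 0) =
    ∑ U : Finset V, ∑ i ∈ U, countSubsets (Finset.univ.filter A) (U.erase i) *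
      countSubsets (Finset.univ.filter B) Uᶜ := by
  unfold disjointWeight
  rw [sum_if_sum_flags (fun x y => A x ∧ B y) (fun U i x y => x ⊆ U.erase i ∧ y ⊆ Uᶜ)]
  refine Finset.sum_congr rfl fun U _ => Finset.sum_congr rfl fun i _ => ?_
  rw [sum_sum_rectangle (fun x => x ⊆ U.erase i) (fun y => y ⊆ Uᶜ) A B]
  unfold countSubsets
  congr!

open Classical in
theorem sum_intersectingWeight_rectangle (A B : Finset V → Prop) :
    (∑ x : Finset V, ∑ y : Finset V, if A x ∧ B y then intersectingWeight x y else 0) =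
    ∑ U : Finset V, ∑ i ∈ U, countThrough (Finset.univ.filter A) i (U.erase i) *
      countThrough (Finset.univ.filter B) i Uᶜ := by
  unfold intersectingWeight
  rw [sum_if_sum_flags (fun x y => A x ∧ B y) (fun U i x y =>
    (i ∈ x ∧ x ⊆ insert i (U.erase i)) ∧ (i ∈ y ∧ y ⊆ insert i Uᶜ))]
  refine Finset.sum_congr rfl fun U _ => Finset.sum_congr rfl fun i _ => ?_
  rw [sum_sum_rectangle (fun x => i ∈ x ∧ x ⊆ insert i (U.erase i))
    (fun y => i ∈ y ∧ y ⊆ insert i Uᶜ) A B]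
  unfold countThrough
  congr!

theorem intersectingWeight_nonneg (x y : Finset V) : 0 ≤ intersectingWeight x y := by
  unfold intersectingWeight
  exact Finset.sum_nonneg fun _ _ => Finset.sum_nonneg fun _ _ => by split_ifs <;> norm_num

theorem disjoint_of_disjointWeight_ne_zero {x y : Finset V} (h : disjointWeight x y ≠ 0) :
    Disjoint x y := by
  obtain ⟨U, -, hU⟩ := Finset.exists_ne_zero_of_sum_ne_zero h
  obtain ⟨i, -, hi⟩ := Finset.exists_ne_zero_of_sum_ne_zero hU
  have hi : x ⊆ U.erase i ∧ y ⊆ Uᶜ := by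
    by_contra hn
    exact hi (if_neg hn)
  exact (disjoint_compl_right (a := U)).mono (hi.1.trans (Finset.erase_subset _ _)) hi.2

theorem inter_eq_singleton_of_intersectingWeight_ne_zero {x y : Finset V}
    (h : intersectingWeight x y ≠ 0) : ∃ i, x ∩ y = {i} := by
  obtain ⟨U, -, hU⟩ := Finset.exists_ne_zero_of_sum_ne_zero h
  obtain ⟨i, hiU, hi⟩ := Finset.exists_ne_zero_of_sum_ne_zero hU
  have hi : (i ∈ x ∧ x ⊆ insert i (U.erase i)) ∧ (i ∈ y ∧ y ⊆ insert i Uᶜ) := by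
    by_contra hn
    exact hi (if_neg hn)
  refine ⟨i, ?_⟩
  ext j
  rw [Finset.mem_inter, Finset.mem_singleton]
  constructor
  · rintro ⟨hx, hy⟩
    have h1 := hi.1.2 hx
    have h2 := hi.2.2 hy
    rw [Finset.insert_erase hiU] at h1
    simp only [Finset.mem_insert, Finset.mem_compl] at h2
    tauto
  · rintro rfl
    exact ⟨hi.1.1, hi.2.1⟩

theorem countSubsets_univ (Z : Finset V) :
    countSubsets (Finset.univ : Finset (Finset V)) Z = 2 ^ Z.card := by
  unfold countSubsets
  rw [← Nat.cast_ofNat, ← Nat.cast_pow, ← Finset.card_powerset]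
  congr 2
  ext x
  simp

theorem countThrough_univ {i : V} {Z : Finset V} (hi : i ∉ Z) :
    countThrough (Finset.univ : Finset (Finset V)) i Z = 2 ^ Z.card := by
  have h := countSubsets_eq_add (Finset.univ : Finset (Finset V)) (Finset.mem_insert_self i Z)
  rw [Finset.erase_insert hi, countSubsets_univ, countSubsets_univ,
    Finset.card_insert_of_notMem hi, pow_succ] at h
  linarith

/-- The common total mass of the two weights. -/
theorem sum_flags_const :
    ∑ U : Finset V, ∑ i ∈ U, (2 : ℝ) ^ (U.erase i).card * 2 ^ Uᶜ.card =
    Fintype.card V * (2 ^ Fintype.card V * 2 ^ Fintype.card V) / 4 := by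
  have h1 : ∀ U : Finset V, ∑ i ∈ U, (2 : ℝ) ^ (U.erase i).card * 2 ^ Uᶜ.card =
      U.card * (2 ^ Fintype.card V / 2) := by
    intro U
    rw [← nsmul_eq_mul, ← Finset.sum_const]
    refine Finset.sum_congr rfl fun i hi => ?_
    rw [← Finset.card_add_card_compl U, pow_add, ← Finset.card_erase_add_one hi, pow_succ]
    ring
  rw [Finset.sum_congr rfl fun U _ => h1 U, ← Finset.sum_mul]
  have h2 : ∑ U : Finset V, (U.card : ℝ) = ∑ U : Finset V, ((Uᶜ).card : ℝ) :=
    (Equiv.sum_comp (Function.Involutive.toPerm (compl : Finset V → Finset V) compl_involutive)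
      (fun U => (U.card : ℝ))).symm
  have h3 : ∑ U : Finset V, (U.card : ℝ) + ∑ U : Finset V, ((Uᶜ).card : ℝ) =
      2 ^ Fintype.card V * Fintype.card V := by
    rw [← Finset.sum_add_distrib]
    have : ∀ U : Finset V, (U.card : ℝ) + (Uᶜ.card : ℝ) = Fintype.card V := fun U => by
      exact_mod_cast Finset.card_add_card_compl U
    rw [Finset.sum_congr rfl fun U _ => this U, Finset.sum_const, Finset.card_univ,
      Fintype.card_finset, nsmul_eq_mul]
    push_cast
    ring
  have h4 : ∑ U : Finset V, (U.card : ℝ) = 2 ^ Fintype.card V * Fintype.card V / 2 := by linarith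
  rw [h4]
  ring

theorem sum_disjointWeight :
    ∑ x : Finset V, ∑ y : Finset V, disjointWeight x y =
      Fintype.card V * (2 ^ Fintype.card V * 2 ^ Fintype.card V) / 4 := by
  have h := sum_disjointWeight_rectangle (V := V) (fun _ => True) (fun _ => True)
  simp only [and_self, if_true, Finset.filter_true, countSubsets_univ] at h
  rw [h, sum_flags_const]

theorem sum_intersectingWeight :
    ∑ x : Finset V, ∑ y : Finset V, intersectingWeight x y =
      Fintype.card V * (2 ^ Fintype.card V * 2 ^ Fintype.card V) / 4 := by
  have h := sum_intersectingWeight_rectangle (V := V) (fun _ => True) (fun _ => True)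
  simp only [and_self, if_true, Finset.filter_true] at h
  rw [h, ← sum_flags_const]
  refine Finset.sum_congr rfl fun U _ => Finset.sum_congr rfl fun i hi => ?_
  rw [countThrough_univ (Finset.notMem_erase i U), countThrough_univ (by simpa using hi)]

open Classical in
theorem sum_if_partition {X Y : Type*} [Fintype X] [Fintype Y] {ι : Type*} [Fintype ι]
    {F : X → Y → Prop} {A : ι → X → Prop} {B : ι → Y → Prop}
    (hF : ∀ x y, F x y ↔ ∃ l, A l x ∧ B l y)
    (hu : ∀ x y l l', A l x → B l y → A l' x → B l' y → l = l') (w : X → Y → ℝ) :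
    (∑ x, ∑ y, if F x y then w x y else 0) =
      ∑ l, ∑ x, ∑ y, if A l x ∧ B l y then w x y else 0 := by
  rw [Finset.sum_comm (s := (Finset.univ : Finset ι))]
  refine Finset.sum_congr rfl fun x _ => ?_
  rw [Finset.sum_comm (s := (Finset.univ : Finset ι))]
  refine Finset.sum_congr rfl fun y _ => ?_
  by_cases h : F x y
  · obtain ⟨l, hl⟩ := (hF x y).1 h
    rw [if_pos h, Finset.sum_eq_single l, if_pos hl]
    · intro l' _ hne
      exact if_neg fun hl' => hne (hu x y _ _ hl'.1 hl'.2 hl.1 hl.2)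
    · simp
  · rw [if_neg h]
    exact (Finset.sum_eq_zero fun l _ => if_neg fun hl => h ((hF x y).2 ⟨l, hl⟩)).symm

open Classical in
/-- A relation that contains all disjoint pairs and is partitioned into few rectangles contains many
of the pairs that intersect in one element. -/
theorem rectangle_partition_bound {F : Finset V → Finset V → Prop} {K : ℕ}
    (hF : IsRectanglePartition F K) (hd : ∀ x y, Disjoint x y → F x y) :
    1 / 2 * (Fintype.card V * (2 ^ Fintype.card V * 2 ^ Fintype.card V) / 4) ≤
      9 * (∑ x : Finset V, ∑ y : Finset V, if F x y then intersectingWeight x y else 0) +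
      K * (2 * corruptionError (Fintype.card V)) := by
  obtain ⟨ι, _, A, B, hι, hAB, hu⟩ := hF
  have h0 : ∑ x : Finset V, ∑ y : Finset V, disjointWeight x y =
      ∑ x : Finset V, ∑ y : Finset V, if F x y then disjointWeight x y else 0 := by
    refine Finset.sum_congr rfl fun x _ => Finset.sum_congr rfl fun y _ => ?_
    split_ifs with h
    · rfl
    · by_contra hne
      exact h (hd x y (disjoint_of_disjointWeight_ne_zero hne))
  rw [sum_disjointWeight, sum_if_partition hAB hu] at h0
  rw [sum_if_partition hAB hu]
  have h1 : ∀ l, (∑ x, ∑ y, if A l x ∧ B l y then disjointWeight x y else 0) ≤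
      1 / 2 * (∑ x, ∑ y, if A l x ∧ B l y then disjointWeight x y else 0) +
      9 * (∑ x, ∑ y, if A l x ∧ B l y then intersectingWeight x y else 0) +
      2 * corruptionError (Fintype.card V) := by
    intro l
    rw [sum_disjointWeight_rectangle, sum_intersectingWeight_rectangle]
    exact corruption_bound _ _
  have h2 := Finset.sum_le_sum fun l (_ : l ∈ Finset.univ) => h1 l
  rw [Finset.sum_add_distrib, Finset.sum_add_distrib, ← Finset.mul_sum, ← Finset.mul_sum, ← h0,
    Finset.sum_const, nsmul_eq_mul, Finset.card_univ] at h2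
  have h3 : (Fintype.card ι : ℝ) * (2 * corruptionError (Fintype.card V)) ≤
      K * (2 * corruptionError (Fintype.card V)) := by
    refine mul_le_mul_of_nonneg_right (by exact_mod_cast hι) ?_
    unfold corruptionError
    positivity
  linarith

end Corruption

/-! ### Communication cost of finding the common element. -/

/-- A protocol of depth `d` partitions the inputs into at most `2 ^ d` rectangles, and inside a
rectangle the output of a player depends only on that player's own input. -/
theorem Protocol.exists_rectangles {X Y OA OB : Type} (P : Protocol X Y OA OB) :
    ∃ (ι : Type) (_ : Fintype ι) (A : ι → X → Prop) (B : ι → Y → Prop) (out : ι → X → OA),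
      Fintype.card ι ≤ 2 ^ P.depth ∧ (∀ x y, ∃ l, A l x ∧ B l y) ∧
      (∀ x y l l', A l x → B l y → A l' x → B l' y → l = l') ∧
      ∀ l x y, A l x → B l y → (P.run x y).1 = out l x := by
  induction P with
  | leaf outA outB =>
    exact ⟨Unit, inferInstance, fun _ _ => True, fun _ _ => True, fun _ => outA, by simp [depth],
      fun _ _ => ⟨(), trivial, trivial⟩, fun _ _ _ _ _ _ _ _ => rfl, fun _ _ _ _ _ => rfl⟩
  | nodeA bit next ih =>
    choose ι hι A B out hcard hcov hu hout using ih
    refine ⟨Σ c, ι c, inferInstance, fun l x => bit x = l.1 ∧ A l.1 l.2 x, fun l y => B l.1 l.2 y,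
      fun l x => out l.1 l.2 x, ?_, ?_, ?_, ?_⟩
    · rw [Fintype.card_sigma, Fintype.sum_bool, depth, pow_succ, mul_two]
      exact add_le_add
        ((hcard true).trans (Nat.pow_le_pow_right two_pos (le_max_right _ _)))
        ((hcard false).trans (Nat.pow_le_pow_right two_pos (le_max_left _ _)))
    · intro x y
      obtain ⟨l, h1, h2⟩ := hcov (bit x) x y
      exact ⟨⟨bit x, l⟩, ⟨rfl, h1⟩, h2⟩
    · rintro x y ⟨c, l⟩ ⟨c', l'⟩ ⟨rfl, h1⟩ h2 ⟨h3, h4⟩ h5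
      obtain rfl : bit x = c' := h3
      rw [hu _ x y l l' h1 h2 h4 h5]
    · rintro ⟨c, l⟩ x y ⟨rfl, h1⟩ h2
      exact hout _ l x y h1 h2
  | nodeB bit next ih =>
    choose ι hι A B out hcard hcov hu hout using ih
    refine ⟨Σ c, ι c, inferInstance, fun l x => A l.1 l.2 x, fun l y => bit y = l.1 ∧ B l.1 l.2 y,
      fun l x => out l.1 l.2 x, ?_, ?_, ?_, ?_⟩
    · rw [Fintype.card_sigma, Fintype.sum_bool, depth, pow_succ, mul_two]
      exact add_le_add
        ((hcard true).trans (Nat.pow_le_pow_right two_pos (le_max_right _ _)))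
        ((hcard false).trans (Nat.pow_le_pow_right two_pos (le_max_left _ _)))
    · intro x y
      obtain ⟨l, h1, h2⟩ := hcov (bit y) x y
      exact ⟨⟨bit y, l⟩, h1, rfl, h2⟩
    · rintro x y ⟨c, l⟩ ⟨c', l'⟩ h1 ⟨rfl, h2⟩ h3 ⟨h4, h5⟩
      obtain rfl : bit y = c' := h4
      rw [hu _ x y l l' h1 h2 h3 h5]
    · rintro ⟨c, l⟩ x y h1 ⟨rfl, h2⟩
      exact hout _ l x y h1 h2

section Search

variable {V : Type} [DecidableEq V] [Fintype V] {X Y OA OB : Type}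

/-- On the inputs that encode the sets `x` and `y`, the output of player `A` names an element of
`x ∩ y`. -/
def Protocol.FindsCommon (P : Protocol X Y OA OB) (dec : OA → Option V) (eX : Finset V → X)
    (eY : Finset V → Y) (x y : Finset V) : Prop :=
  ∃ i, dec (P.run (eX x) (eY y)).1 = some i ∧ i ∈ x ∧ i ∈ y

/-- Within a leaf rectangle the name announced by `A` depends on `x` alone. Splitting by that name,
set to `none` unless it lies in `x`, turns failure into the condition on `y` that the name is not in
`y`. -/
theorem Protocol.isRectanglePartition_not_findsCommon (P : Protocol X Y OA OB)
    (dec : OA → Option V) (eX : Finset V → X) (eY : Finset V → Y) {C : ℕ} (hC : P.depth ≤ C) :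
    IsRectanglePartition (fun x y => ¬ P.FindsCommon dec eX eY x y)
      (2 ^ C * (Fintype.card V + 1)) := by
  obtain ⟨ι, _, A, B, out, hcard, hcov, hu, hout⟩ := P.exists_rectangles
  set o : ι → Finset V → Option V := fun l x => (dec (out l (eX x))).filter (· ∈ x) with ho
  refine ⟨ι × Option V, inferInstance, fun l x => A l.1 (eX x) ∧ o l.1 x = l.2,
    fun l y => B l.1 (eY y) ∧ ∀ i, l.2 = some i → i ∉ y, ?_, ?_, ?_⟩
  · rw [Fintype.card_prod, Fintype.card_option]
    exact Nat.mul_le_mul_right _ (hcard.trans (Nat.pow_le_pow_right two_pos hC))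
  · intro x y
    constructor
    · intro h
      obtain ⟨l, h1, h2⟩ := hcov (eX x) (eY y)
      refine ⟨(l, o l x), ⟨h1, rfl⟩, h2, fun i hi hy => h ⟨i, ?_, ?_, hy⟩⟩
      · rw [hout l _ _ h1 h2]
        exact (Option.filter_eq_some_iff.1 hi).1
      · simpa using (Option.filter_eq_some_iff.1 hi).2
    · rintro ⟨⟨l, o'⟩, ⟨h1, h0⟩, h2, h3⟩ ⟨i, hi, hx, hy⟩
      have h0 : o l x = o' := h0
      subst h0
      refine h3 i ?_ hy
      rw [hout l _ _ h1 h2] at hi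
      exact Option.filter_eq_some_iff.2 ⟨hi, by simpa using hx⟩
  · rintro x y ⟨l, a⟩ ⟨l', a'⟩ ⟨h1, ha⟩ ⟨h2, -⟩ ⟨h3, ha'⟩ ⟨h4, -⟩
    obtain rfl : l = l' := hu _ _ l l' h1 h2 h3 h4
    exact Prod.ext rfl (ha.symm.trans ha')

open Classical in
/-- If every event has outer measure at most `1 / 3`, some outcome lies in events of at most a third
of the total weight. -/
theorem exists_sum_indicator_le {Ω : Type u} [MeasurableSpace Ω] (μ : Measure Ω)
    [IsProbabilityMeasure μ] {α : Type*} [Fintype α] (w : α → ℝ) (hw : ∀ a, 0 ≤ w a)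
    (E : α → Set Ω) (hE : ∀ a, w a ≠ 0 → μ (E a) ≤ 1 / 3) :
    ∃ ω, (∑ a, if ω ∈ E a then w a else 0) ≤ 1 / 3 * ∑ a, w a := by
  -- The events need not be measurable, so measurable hulls of the same measure are averaged
  -- instead.
  set f : Ω → ℝ := fun ω => ∑ a, (toMeasurable μ (E a)).indicator (fun _ => w a) ω with hf
  have hint : ∀ a, Integrable ((toMeasurable μ (E a)).indicator (fun _ => w a)) μ := fun a =>
    (integrable_const _).indicator (measurableSet_toMeasurable _ _)
  obtain ⟨ω, hω⟩ := exists_le_integral (μ := μ) (f := f) (integrable_finsetSum _ fun a _ => hint a)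
  refine ⟨ω, ?_⟩
  have h1 : (∑ a, if ω ∈ E a then w a else 0) ≤ f ω := by
    refine Finset.sum_le_sum fun a _ => ?_
    split_ifs with h
    · rw [Set.indicator_of_mem (subset_toMeasurable _ _ h)]
    · exact Set.indicator_nonneg (fun _ _ => hw a) _
  refine h1.trans (hω.trans ?_)
  rw [hf, integral_finsetSum _ fun a _ => hint a, Finset.mul_sum]
  refine Finset.sum_le_sum fun a _ => ?_
  rw [integral_indicator_const _ (measurableSet_toMeasurable _ _), smul_eq_mul]
  by_cases h0 : w a = 0
  · simp [h0]
  refine mul_le_mul_of_nonneg_right ?_ (hw a)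
  rw [measureReal_def, measure_toMeasurable]
  have := ENNReal.toReal_mono (by simp) (hE a h0)
  simpa using this

/-- The randomized protocol finds the common element of two sets that have exactly one. -/
def RandomizedProtocol.FindsUniqueCommon (π : RandomizedProtocol.{u} X Y OA OB)
    (dec : OA → Option V) (eX : Finset V → X) (eY : Finset V → Y) : Prop :=
  ∀ x y i, x ∩ y = {i} →
    letI := π.measurableSpace
    π.prob {ω | ¬ (π.protocol ω).FindsCommon dec eX eY x y} ≤ 1 / 3

-- Averaging over the coins, relative to the weight inside `F`, allows iteration: each new outcome
-- cuts the surviving failure weight to a third.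
open Classical in
theorem RandomizedProtocol.FindsUniqueCommon.exists_protocol
    {π : RandomizedProtocol.{u} X Y OA OB} {dec : OA → Option V} {eX : Finset V → X}
    {eY : Finset V → Y} (h : π.FindsUniqueCommon dec eX eY) (F : Finset V → Finset V → Prop) :
    ∃ ω, ∀ G : Finset V → Finset V → Prop,
      (∀ x y, G x y ↔ F x y ∧ ¬ (π.protocol ω).FindsCommon dec eX eY x y) →
      (∑ x, ∑ y, if G x y then intersectingWeight x y else 0) ≤
      1 / 3 * ∑ x, ∑ y, if F x y then intersectingWeight x y else 0 := by
  let _ := π.measurableSpace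
  have := π.isProbabilityMeasure
  obtain ⟨ω, hω⟩ := exists_sum_indicator_le π.prob
    (fun p : Finset V × Finset V => if F p.1 p.2 then intersectingWeight p.1 p.2 else 0)
    (fun p => by
      split_ifs
      · exact intersectingWeight_nonneg _ _
      · exact le_rfl)
    (fun p => {ω | ¬ (π.protocol ω).FindsCommon dec eX eY p.1 p.2})
    (fun p hp => by
      obtain ⟨i, hi⟩ := inter_eq_singleton_of_intersectingWeight_ne_zero
        (fun h0 => hp (by simp [h0]) : intersectingWeight p.1 p.2 ≠ 0)
      exact h _ _ i hi)
  refine ⟨ω, fun G hG => ?_⟩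
  rw [Fintype.sum_prod_type, Fintype.sum_prod_type] at hω
  refine le_trans (le_of_eq ?_) hω
  refine Finset.sum_congr rfl fun x _ => Finset.sum_congr rfl fun y _ => ?_
  have hG := hG x y
  by_cases h1 : F x y <;> by_cases h2 : (π.protocol ω).FindsCommon dec eX eY x y <;>
    simp_all

theorem RandomizedProtocol.FindsUniqueCommon.pow_bound
    {π : RandomizedProtocol.{u} X Y OA OB} {dec : OA → Option V} {eX : Finset V → X}
    {eY : Finset V → Y} (h : π.FindsUniqueCommon dec eX eY) {C : ℕ} (hC : π.CostAtMost C)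
    [Nonempty V] :
    1 ≤ 48 * (2 ^ C * (Fintype.card V + 1) : ℝ) ^ 3 *
      ((1 + Real.exp (-1 / 160)) / 2) ^ Fintype.card V := by
  classical
  set N : π.Coins → Finset V → Finset V → Prop :=
    fun ω x y => ¬ (π.protocol ω).FindsCommon dec eX eY x y with hN
  -- Three outcomes bring the failure weight to `1/27`, and `9 / 27 < 1 / 2` beats the corruption
  -- constant; two would only give `9 / 9`. The gap `1/2 - 1/3`, the mass `m D / 4` and the factor
  -- `2` of the error yield `48`.
  obtain ⟨ω₁, h1⟩ := h.exists_protocol (fun _ _ => True)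
  obtain ⟨ω₂, h2⟩ := h.exists_protocol (N ω₁)
  obtain ⟨ω₃, h3⟩ := h.exists_protocol (fun x y => N ω₁ x y ∧ N ω₂ x y)
  have hrect : ∀ ω, IsRectanglePartition (N ω) (2 ^ C * (Fintype.card V + 1)) := fun ω =>
    (π.protocol ω).isRectanglePartition_not_findsCommon dec eX eY (hC ω)
  have hd : ∀ ω (x y : Finset V), Disjoint x y → N ω x y := by
    rintro ω x y hxy ⟨i, -, hx, hy⟩
    exact Finset.disjoint_left.1 hxy hx hy
  have hb := rectangle_partition_bound (((hrect ω₁).and (hrect ω₂)).and (hrect ω₃))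
    fun x y hxy => ⟨⟨hd ω₁ x y hxy, hd ω₂ x y hxy⟩, hd ω₃ x y hxy⟩
  have h1 := h1 (N ω₁) fun x y => by simp [hN]
  have h2 := h2 (fun x y => N ω₁ x y ∧ N ω₂ x y) fun x y => Iff.rfl
  have h3 := h3 (fun x y => (N ω₁ x y ∧ N ω₂ x y) ∧ N ω₃ x y) fun x y => Iff.rfl
  simp only [if_true, sum_intersectingWeight] at h1
  set m := Fintype.card V with hm
  have hm0 : (0 : ℝ) < m := by exact_mod_cast Fintype.card_pos
  set D : ℝ := 2 ^ m * 2 ^ m with hD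
  have hD0 : 0 < D := by positivity
  have herr : corruptionError m = m * D * ((1 + Real.exp (-1 / 160)) / 2) ^ m := by
    unfold corruptionError
    rw [hD, div_pow]
    field_simp
  rw [herr] at hb
  push_cast at hb
  set L : ℝ := 2 ^ C * (m + 1)
  set r : ℝ := ((1 + Real.exp (-1 / 160)) / 2) ^ m
  have h4 : 0 ≤ (m * D) * (48 * L ^ 3 * r - 1) := by
    have h5 : (L * L * L) * (2 * (m * D * r)) = (m * D) * (2 * L ^ 3 * r) := by ring
    rw [h5] at hb
    nlinarith
  have h6 := nonneg_of_mul_nonneg_right h4 (by positivity)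
  linarith

theorem Protocol.run_fst_eq_of_depth_eq_zero (P : Protocol X Y OA OB) (h : P.depth = 0) (x : X)
    (y y' : Y) : (P.run x y).1 = (P.run x y').1 := by
  cases P with
  | leaf => rfl
  | nodeA => simp [depth] at h
  | nodeB => simp [depth] at h

/-- Without communication `A` names the same element of `{i, j}` whether `B` holds `{i}` or `{j}`,
so the two error probabilities sum to at least `1`. This secures `1 ≤ C`, which absorbs additive
constants for small ground sets. -/
theorem RandomizedProtocol.FindsUniqueCommon.cost_ne_zero {V : Type} [DecidableEq V]
    {π : RandomizedProtocol.{u} X Y OA OB} {dec : OA → Option V} {eX : Finset V → X}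
    {eY : Finset V → Y} (h : π.FindsUniqueCommon dec eX eY) [Nontrivial V] :
    ¬ π.CostAtMost 0 := by
  intro hC
  let _ := π.measurableSpace
  have := π.isProbabilityMeasure
  obtain ⟨i, j, hij⟩ := exists_pair_ne V
  have hi := h {i, j} {i} i (by ext k; simp)
  have hj := h {i, j} {j} j (by ext k; simp)
  have huniv : (Set.univ : Set π.Coins) ⊆
      {ω | ¬ (π.protocol ω).FindsCommon dec eX eY {i, j} {i}} ∪
      {ω | ¬ (π.protocol ω).FindsCommon dec eX eY {i, j} {j}} := by
    intro ω _
    by_contra hn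
    rw [Set.mem_union, not_or] at hn
    obtain ⟨⟨a, ha, -, hai⟩, b, hb, -, hbj⟩ := And.imp not_not.1 not_not.1 hn
    rw [(π.protocol ω).run_fst_eq_of_depth_eq_zero (Nat.le_zero.1 (hC ω)) _ _ (eY {j}), hb] at ha
    rw [Finset.mem_singleton] at hai hbj
    exact hij (by rw [← hai, ← hbj, Option.some.inj ha])
  have h1 := (measure_mono huniv).trans ((measure_union_le _ _).trans (add_le_add hi hj))
  rw [measure_univ] at h1
  have h2 := ENNReal.toReal_mono (by simp) h1
  rw [ENNReal.toReal_add (by simp) (by simp)] at h2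
  norm_num at h2

theorem exists_linear_bound_of_pow_bound :
    ∃ c : ℝ, 0 < c ∧ ∀ C M : ℕ, 1 ≤ C →
      1 ≤ 48 * (2 ^ C * (M + 1) : ℝ) ^ 3 * ((1 + Real.exp (-1 / 160)) / 2) ^ M → c * M ≤ C := by
  set r : ℝ := (1 + Real.exp (-1 / 160)) / 2 with hr
  have hr0 : 0 < r := by positivity
  have hr1 : r < 1 := by
    have : Real.exp (-1 / 160) < 1 := Real.exp_zero ▸ Real.exp_lt_exp.2 (by norm_num)
    rw [hr]; linarith
  set t : ℝ := -Real.log r with ht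
  have ht0 : 0 < t := by
    have := Real.log_neg hr0 hr1
    linarith
  set K : ℝ := Real.log 48 + t / 2 - 3 - 3 * Real.log (t / 6) with hK
  have hlog2 : 0 < Real.log 2 := Real.log_pos (by norm_num)
  refine ⟨t / 2 / (3 * Real.log 2 + |K|), by positivity, fun C M hC h => ?_⟩
  have hC1 : (1 : ℝ) ≤ C := by exact_mod_cast hC
  have h1 := Real.log_nonneg h
  rw [Real.log_mul (by positivity) (by positivity), Real.log_mul (by positivity) (by positivity),
    Real.log_pow, Real.log_pow, Real.log_mul (by positivity) (by positivity), Real.log_pow] at h1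
  -- The tangent bound with slope `t / 6` makes `3 log (M + 1)` cost only half of the decay `t M`.
  have h2 := Real.log_le_sub_one_of_pos (show 0 < t / 6 * ((M : ℝ) + 1) by positivity)
  rw [Real.log_mul (by positivity) (by positivity)] at h2
  have h3 : K ≤ |K| * C := (le_abs_self K).trans (le_mul_of_one_le_right (abs_nonneg K) hC1)
  rw [div_mul_eq_mul_div, div_le_iff₀ (by positivity)]
  push_cast at h1
  have h4 : (M : ℝ) * Real.log r = -(M * t) := by rw [ht]; ring
  rw [h4] at h1
  linarith

/-- Finding the common element of two subsets of `V` that have exactly one common element takes a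
number of bits linear in the size of `V`. -/
theorem exists_linear_bound_findsUniqueCommon :
    ∃ c : ℝ, 0 < c ∧ ∀ {V : Type} [DecidableEq V] [Fintype V] [Nontrivial V] {X Y OA OB : Type}
      (π : RandomizedProtocol.{u} X Y OA OB) (dec : OA → Option V) (eX : Finset V → X)
      (eY : Finset V → Y), π.FindsUniqueCommon dec eX eY →
        ∀ C : ℕ, π.CostAtMost C → c * Fintype.card V ≤ C := by
  obtain ⟨c, hc, hbound⟩ := exists_linear_bound_of_pow_bound
  refine ⟨c, hc, fun π dec eX eY h C hC => hbound C _ ?_ (h.pow_bound hC)⟩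
  rw [Nat.one_le_iff_ne_zero]
  rintro rfl
  exact h.cost_ne_zero hC

end Search

/-! ### Approximate best responses when every action has a unique answer. -/

section BestResponse

variable {V : Type} [Fintype V]

/-- In the game where a player is paid `1` for playing `f v` when the opponent plays `v`, no mixed
strategy is better than `a` against `b` by more than `ε`. -/
def IsApproxBestResponse (ε : ℝ) (f : V → V) (a b : stdSimplex ℝ V) : Prop :=
  ∀ a' : stdSimplex ℝ V, ∑ v, b v * a' (f v) - ∑ v, b v * a (f v) ≤ ε

variable [DecidableEq V]

/-- The payoff of the pure strategy `u` against `b` if the best answer to `v` is `f v`. -/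
def purePayoff (f : V → V) (b : stdSimplex ℝ V) (u : V) : ℝ := ∑ v, if f v = u then b v else 0

theorem sum_mul_purePayoff (f : V → V) (b : stdSimplex ℝ V) (a : V → ℝ) :
    ∑ v, b v * a (f v) = ∑ u, a u * purePayoff f b u := by
  unfold purePayoff
  simp only [Finset.mul_sum]
  rw [Finset.sum_comm]
  refine Finset.sum_congr rfl fun v _ => ?_
  simp [mul_comm]

theorem sum_purePayoff (f : V → V) (b : stdSimplex ℝ V) : ∑ u, purePayoff f b u = 1 := by
  have h := sum_mul_purePayoff f b (fun _ => 1)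
  simp only [one_mul, mul_one] at h
  rw [← h]
  exact b.2.2

theorem IsApproxBestResponse.sum_regret_le {ε : ℝ} {f : V → V} {a b : stdSimplex ℝ V}
    (h : IsApproxBestResponse ε f a b) (u' : V) :
    ∑ u, a u * (purePayoff f b u' - purePayoff f b u) ≤ ε := by
  have h1 := h ⟨Pi.single u' 1, single_mem_stdSimplex ℝ u'⟩
  rw [sum_mul_purePayoff f b, sum_mul_purePayoff f b] at h1
  have h2 : ∑ u, (Pi.single u' 1 : V → ℝ) u * purePayoff f b u = purePayoff f b u' := by
    simp [Pi.single_apply]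
  have h3 : ∑ u, a u * (purePayoff f b u' - purePayoff f b u) =
      purePayoff f b u' - ∑ u, a u * purePayoff f b u := by
    simp only [mul_sub, Finset.sum_sub_distrib, ← Finset.sum_mul]
    rw [show ∑ u, a u = 1 from a.2.2, one_mul]
  rw [h3, ← h2]
  exact h1

theorem IsApproxBestResponse.mul_regret_le {ε : ℝ} {f : V → V} {a b : stdSimplex ℝ V}
    (h : IsApproxBestResponse ε f a b) {u' : V}
    (hu' : ∀ u, purePayoff f b u ≤ purePayoff f b u') (u : V) :
    a u * (purePayoff f b u' - purePayoff f b u) ≤ ε :=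
  (Finset.single_le_sum (f := fun u => a u * (purePayoff f b u' - purePayoff f b u))
    (fun w _ => mul_nonneg (a.2.1 w) (sub_nonneg.2 (hu' w))) (Finset.mem_univ u)).trans
    (h.sum_regret_le u')

/-- Put `d = 1 / (4N)`. Pure payoffs sum to `1`, so the best is at least `4 d`. If all of the at
most three preimages of `u` had mass below `d`, then `u` would earn less than `3 d`, and its mass
`d` times a regret above `d` would exceed `d ^ 2 ≥ ε`. -/
theorem IsApproxBestResponse.exists_preimage {ε : ℝ} {f : V → V} {a b : stdSimplex ℝ V}
    (h : IsApproxBestResponse ε f a b) (hε : ε ≤ 1 / (16 * (Fintype.card V : ℝ) ^ 2))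
    (hf : ∀ u, (Finset.univ.filter (fun v => f v = u)).card ≤ 3) {u : V}
    (hu : 1 / (4 * (Fintype.card V : ℝ)) ≤ a u) :
    ∃ v, f v = u ∧ 1 / (4 * (Fintype.card V : ℝ)) ≤ b v := by
  by_contra! hn
  have : Nonempty V := ⟨u⟩
  have hN : (0 : ℝ) < Fintype.card V := by exact_mod_cast Fintype.card_pos
  obtain ⟨u', hu'⟩ := Finite.exists_max (purePayoff f b)
  have hmax : 1 / (Fintype.card V : ℝ) ≤ purePayoff f b u' := by
    rw [div_le_iff₀ hN, mul_comm, ← nsmul_eq_mul, ← Finset.card_univ, ← Finset.sum_const,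
      ← sum_purePayoff f b]
    exact Finset.sum_le_sum fun w _ => hu' w
  have hlt : purePayoff f b u < 3 * (1 / (4 * (Fintype.card V : ℝ))) := by
    unfold purePayoff
    rw [← Finset.sum_filter]
    by_cases he : (Finset.univ.filter (fun v => f v = u)).Nonempty
    · calc ∑ v ∈ Finset.univ.filter (fun v => f v = u), b v
          < ∑ v ∈ Finset.univ.filter (fun v => f v = u), 1 / (4 * (Fintype.card V : ℝ)) :=
            Finset.sum_lt_sum_of_nonempty he fun v hv => hn v (by simpa using hv)
        _ ≤ _ := by
            rw [Finset.sum_const, nsmul_eq_mul]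
            exact mul_le_mul_of_nonneg_right (by exact_mod_cast hf u) (by positivity)
    · rw [Finset.not_nonempty_iff_eq_empty.1 he, Finset.sum_empty]
      positivity
  have h1 := h.mul_regret_le hu' u
  set d := 1 / (4 * (Fintype.card V : ℝ)) with hd
  have hd0 : 0 < d := by positivity
  have h2 : 1 / (Fintype.card V : ℝ) = 4 * d := by rw [hd]; field_simp
  have h3 : 1 / (16 * (Fintype.card V : ℝ) ^ 2) = d * d := by rw [hd]; field_simp; norm_num
  rw [h2] at hmax
  rw [h3] at hε
  have h4 : d * d < a u * (purePayoff f b u' - purePayoff f b u) :=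
    mul_lt_mul' hu (by linarith) hd0.le (hd0.trans_le hu)
  linarith

theorem le_purePayoff_apply (f : V → V) (b : stdSimplex ℝ V) (v : V) :
    b v ≤ purePayoff f b (f v) := by
  unfold purePayoff
  refine le_trans (le_of_eq ?_) (Finset.single_le_sum (f := fun x => if f x = f v then b x else 0)
    (fun x _ => ?_) (Finset.mem_univ v))
  · simp
  · split_ifs
    exacts [b.2.1 x, le_rfl]

theorem add_purePayoff_le_one (f : V → V) (b : stdSimplex ℝ V) {v w : V} (h : f v ≠ w) :
    b v + purePayoff f b w ≤ 1 := by
  have h1 := le_purePayoff_apply f b v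
  have h2 : purePayoff f b (f v) + purePayoff f b w ≤ ∑ x, purePayoff f b x := by
    rw [← Finset.sum_pair h]
    refine Finset.sum_le_sum_of_subset_of_nonneg (Finset.subset_univ _) fun x _ _ => ?_
    exact Finset.sum_nonneg fun y _ => by split_ifs; exacts [b.2.1 y, le_rfl]
  rw [sum_purePayoff] at h2
  linarith

/-- If both players respond almost optimally and one of them mostly plays `u`, then `u` lies on a
2-cycle of the best responses. -/
theorem apply_apply_eq_of_three_quarters_le {ε : ℝ} (hε : ε ≤ 1 / 16) {f g : V → V}
    {a b : stdSimplex ℝ V} (ha : IsApproxBestResponse ε f a b) (hb : IsApproxBestResponse ε g b a)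
    {u : V} (hu : 3 / 4 ≤ a u) : f (g u) = u := by
  by_contra hne
  have hQ : ∀ v, v ≠ g u → purePayoff g a v ≤ 1 / 4 := fun v hv => by
    have := add_purePayoff_le_one g a (v := u) (Ne.symm hv)
    linarith
  have hQu := le_purePayoff_apply g a u
  have h1 := hb.sum_regret_le (g u)
  have h2 : (1 - b (g u)) / 2 ≤ ∑ v, b v * (purePayoff g a (g u) - purePayoff g a v) := by
    have hs : ∑ v, b v = 1 := b.2.2
    rw [← Finset.add_sum_erase _ _ (Finset.mem_univ (g u))] at hs ⊢
    have h3 : (∑ v ∈ Finset.univ.erase (g u), b v) * (1 / 2) ≤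
        ∑ v ∈ Finset.univ.erase (g u), b v * (purePayoff g a (g u) - purePayoff g a v) := by
      rw [Finset.sum_mul]
      refine Finset.sum_le_sum fun v hv => mul_le_mul_of_nonneg_left ?_ (b.2.1 v)
      have := hQ v (Finset.ne_of_mem_erase hv)
      linarith
    rw [sub_self, mul_zero, zero_add]
    linarith
  -- Every answer other than `g u` loses at least `1/2`, so at most `2 ε ≤ 1/8` of the mass is
  -- elsewhere. If `f (g u) ≠ u`, then `u` in turn has regret at least `3/4` on mass `3/4`, far
  -- above `ε`.
  have hb1 : 7 / 8 ≤ b (g u) := by linarith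
  have hP := le_purePayoff_apply f b (g u)
  have hPw : ∀ w, w ≠ f (g u) → purePayoff f b w ≤ 1 / 8 := fun w hw => by
    have := add_purePayoff_le_one f b (v := g u) (Ne.symm hw)
    linarith
  have hmax : ∀ w, purePayoff f b w ≤ purePayoff f b (f (g u)) := by
    intro w
    by_cases hw : w = f (g u)
    · rw [hw]
    · have := hPw w hw
      linarith
  have h4 := ha.mul_regret_le hmax u
  have h5 := hPw u (Ne.symm hne)
  nlinarith

end BestResponse

/-! ### Mutually covering finite sets. -/

section Cycles

variable {V : Type} [DecidableEq V]

/-- Two finite sets, each covered by the image of the other, are mapped onto each other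
bijectively; removing a 2-cycle preserves this. -/
theorem closed_erase_of_two_cycle {f g : V → V} {SA SB : Finset V}
    (hA : ∀ u ∈ SA, ∃ v ∈ SB, f v = u) (hB : ∀ v ∈ SB, ∃ u ∈ SA, g u = v) {u₀ v₀ : V}
    (hf : f v₀ = u₀) (hg : g u₀ = v₀) :
    (∀ u ∈ SA.erase u₀, g u ∈ SB.erase v₀) ∧ (∀ v ∈ SB.erase v₀, f v ∈ SA.erase u₀) ∧
    (∀ u ∈ SA.erase u₀, ∃ v ∈ SB.erase v₀, f v = u) ∧
    (∀ v ∈ SB.erase v₀, ∃ u ∈ SA.erase u₀, g u = v) := by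
  have hAi : SA ⊆ SB.image f := fun u hu => by
    obtain ⟨v, hv, h⟩ := hA u hu
    exact Finset.mem_image.2 ⟨v, hv, h⟩
  have hBi : SB ⊆ SA.image g := fun v hv => by
    obtain ⟨u, hu, h⟩ := hB v hv
    exact Finset.mem_image.2 ⟨u, hu, h⟩
  -- The chain `|SA| ≤ |f(SB)| ≤ |SB| ≤ |g(SA)| ≤ |SA|` collapses to equalities.
  have c1 := Finset.card_le_card hAi
  have c2 := Finset.card_le_card hBi
  have c3 : (SB.image f).card ≤ SB.card := Finset.card_image_le
  have c4 : (SA.image g).card ≤ SA.card := Finset.card_image_le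
  have hfi : SA = SB.image f := Finset.eq_of_subset_of_card_le hAi (by omega)
  have hgi : SB = SA.image g := Finset.eq_of_subset_of_card_le hBi (by omega)
  have finj : Set.InjOn f SB := Finset.card_image_iff.1 (by omega)
  have ginj : Set.InjOn g SA := Finset.card_image_iff.1 (by omega)
  have hfm : ∀ v ∈ SB, f v ∈ SA := fun v hv => hfi ▸ Finset.mem_image_of_mem f hv
  have hgm : ∀ u ∈ SA, g u ∈ SB := fun u hu => hgi ▸ Finset.mem_image_of_mem g hu
  simp only [Finset.mem_erase]
  refine ⟨fun u hu => ⟨fun h => hu.1 ?_, hgm u hu.2⟩, fun v hv => ⟨fun h => hv.1 ?_, hfm v hv.2⟩,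
    fun u hu => ?_, fun v hv => ?_⟩
  · have hv₀ : v₀ ∈ SB := h ▸ hgm u hu.2
    exact ginj hu.2 (hf ▸ hfm v₀ hv₀) (h.trans hg.symm)
  · have hu₀ : u₀ ∈ SA := h ▸ hfm v hv.2
    exact finj hv.2 (hg ▸ hgm u₀ hu₀) (h.trans hf.symm)
  · obtain ⟨v, hv, h⟩ := hA u hu.2
    exact ⟨v, ⟨fun h' => hu.1 (by rw [← h, h', hf]), hv⟩, h⟩
  · obtain ⟨u, hu, h⟩ := hB v hv.2
    exact ⟨u, ⟨fun h' => hv.1 (by rw [← h, h', hg]), hu⟩, h⟩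

end Cycles

/-! ### The graphs of the 2-cycle game. -/

section TwoCycle

variable {n : ℕ} [NeZero n]

/-- The unique out-neighbour of a vertex in the graph of player `A`. -/
def stepA (x : Fin n → Bool) : Vertex n → Vertex n
  | (i, .l1) => (i + 1, if x (i + 1) then .l11 else .l0)
  | (i, .l0) => if x i then (i - 1, bitLabel (x (i - 1)))
      else (i + 1, if x (i + 1) then .l01 else .l0)
  | (i, .l01) => (i, .l1)
  | (i, .l11) => (i, .l1)

/-- The unique out-neighbour of a vertex in the graph of player `B`. -/
def stepB (y : Fin n → Bool) : Vertex n → Vertex n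
  | (i, .l1) => (i + 1, if y (i + 1) then .l11 else .l0)
  | (i, .l0) => (i + 1, if y (i + 1) then .l01 else .l0)
  | (i, .l01) => (i, .l1)
  | (i, .l11) => (i, .l1)

theorem edgeA_iff (x : Fin n → Bool) (u v : Vertex n) : EdgeA x u v ↔ stepA x u = v := by
  constructor
  · rintro (i | ⟨i, h⟩ | ⟨i, h⟩ | i | i) <;> simp [stepA, *]
  · rintro rfl
    obtain ⟨i, z⟩ := u
    cases z
    · by_cases h : x i
      · simpa only [stepA, h, if_true] using EdgeA.back i h
      · rw [Bool.not_eq_true] at h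
        simpa [stepA, h] using EdgeA.zero i h
    · exact EdgeA.one i
    · exact EdgeA.mid01 i
    · exact EdgeA.mid11 i

theorem edgeB_iff (y : Fin n → Bool) (u v : Vertex n) : EdgeB y u v ↔ stepB y u = v := by
  constructor
  · rintro (i | i | i | i) <;> rfl
  · rintro rfl
    obtain ⟨i, z⟩ := u
    cases z
    · exact EdgeB.zero i
    · exact EdgeB.one i
    · exact EdgeB.mid01 i
    · exact EdgeB.mid11 i

theorem bitLabel_eq (c : Bool) : bitLabel c = .l0 ∨ bitLabel c = .l1 := by
  cases c <;> simp [bitLabel]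

theorem card_stepA_fiber_le (x : Fin n → Bool) (u : Vertex n) :
    (Finset.univ.filter (fun v => stepA x v = u)).card ≤ 3 := by
  obtain ⟨j, z⟩ := u
  have hsub : ∀ s : Finset (Vertex n), (∀ v, stepA x v = (j, z) → v ∈ s) → s.card ≤ 3 →
      (Finset.univ.filter (fun v => stepA x v = (j, z))).card ≤ 3 := fun s hs hc =>
    (Finset.card_le_card fun v hv => hs v (by simpa using hv)).trans hc
  by_cases hz : z = .l1
  · subst hz
    refine hsub {(j, .l01), (j, .l11), (j + 1, .l0)} ?_ Finset.card_le_three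
    rintro ⟨i, w⟩ h
    cases w
    · simp only [stepA] at h
      split_ifs at h <;> simp_all [Prod.ext_iff]
      simp [← h.1]
    · simp only [stepA] at h
      split_ifs at h <;> simp_all [Prod.ext_iff]
    · simp_all [stepA]
    · simp_all [stepA]
  · refine hsub {(j - 1, .l1), (j - 1, .l0), (j + 1, .l0)} ?_ Finset.card_le_three
    rintro ⟨i, w⟩ h
    cases w
    · simp only [stepA] at h
      split_ifs at h <;> simp_all [Prod.ext_iff]
      all_goals simp [← h.1]
    · simp only [stepA, Prod.ext_iff] at h
      simp [← h.1]
    · simp_all [stepA]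
    · simp_all [stepA]

theorem card_stepB_fiber_le (y : Fin n → Bool) (u : Vertex n) :
    (Finset.univ.filter (fun v => stepB y v = u)).card ≤ 3 := by
  obtain ⟨j, z⟩ := u
  have hsub : ∀ s : Finset (Vertex n), (∀ v, stepB y v = (j, z) → v ∈ s) → s.card ≤ 3 →
      (Finset.univ.filter (fun v => stepB y v = (j, z))).card ≤ 3 := fun s hs hc =>
    (Finset.card_le_card fun v hv => hs v (by simpa using hv)).trans hc
  by_cases hz : z = .l1
  · subst hz
    -- The repeated element only pads the list to length three.
    refine hsub {(j, .l01), (j, .l11), (j, .l11)} ?_ Finset.card_le_three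
    rintro ⟨i, w⟩ h
    cases w
    · simp only [stepB] at h
      split_ifs at h <;> simp_all [Prod.ext_iff]
    · simp only [stepB] at h
      split_ifs at h <;> simp_all [Prod.ext_iff]
    · simp_all [stepB]
    · simp_all [stepB]
  · refine hsub {(j - 1, .l1), (j - 1, .l0), (j - 1, .l0)} ?_ Finset.card_le_three
    rintro ⟨i, w⟩ h
    cases w
    · simp only [stepB, Prod.ext_iff] at h
      simp [← h.1]
    · simp only [stepB, Prod.ext_iff] at h
      simp [← h.1]
    · simp_all [stepB]
    · simp_all [stepB]

/-- A 2-cycle through a vertex with label `0` sits at an index with `x > y`. -/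
theorem bits_of_two_cycle (hn : 3 ≤ n) {x y : Fin n → Bool} {j : Fin n}
    (h : stepA x (stepB y (j, .l0)) = (j, .l0)) : x (j + 1) = true ∧ y (j + 1) = false := by
  have h1 : (1 : Fin n) ≠ 0 := by
    intro h0
    have := congrArg Fin.val h0
    rw [Fin.val_one', Fin.val_zero, Nat.mod_eq_of_lt (by omega)] at this
    omega
  have h2 : (1 + 1 : Fin n) ≠ 0 := by
    intro h0
    have := congrArg Fin.val h0
    have h3 : 1 % n = 1 := Nat.mod_eq_of_lt (by omega)
    rw [Fin.val_add, Fin.val_one', Fin.val_zero, h3, Nat.mod_eq_of_lt (by omega)] at this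
    omega
  cases hy : y (j + 1) <;> cases hx : x (j + 1) <;> simp [stepB, stepA, hy, hx] at h ⊢
  -- Only both bits `0` remains: the path moves forward twice, and `j + 2 ≠ j` because `n ≥ 3`.
  exact h2 (by simpa [add_assoc] using h.1)

theorem bit_of_stepA_eq_mid {x : Fin n → Bool} {v : Vertex n} {j : Fin n} {z : Label}
    (h : stepA x v = (j, z)) (hz : z = .l01 ∨ z = .l11) : x j = true := by
  by_contra hx
  rw [Bool.not_eq_true] at hx
  obtain ⟨k, w⟩ := v
  cases w
  · by_cases hk : x k
    · simp only [stepA, hk, if_true, Prod.mk.injEq] at h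
      rcases bitLabel_eq (x (k - 1)) with hb | hb <;> rw [hb] at h <;> simp [← h.2] at hz
    · simp only [stepA, hk, Bool.false_eq_true, if_false, Prod.mk.injEq] at h
      obtain ⟨rfl, h⟩ := h
      simp [hx] at h
      simp [← h] at hz
  · simp only [stepA, Prod.mk.injEq] at h
    obtain ⟨rfl, h⟩ := h
    simp [hx] at h
    simp [← h] at hz
  · simp only [stepA, Prod.mk.injEq] at h
    simp [← h.2] at hz
  · simp only [stepA, Prod.mk.injEq] at h
    simp [← h.2] at hz

open Fin.NatCast Fin.CommRing in
/-- Sets of vertices closed under both steps, forwards and backwards, are empty if they avoid the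
2-cycle at `i`, provided the index before `i` has `x = 0` and `y = 1`. -/
theorem eq_empty_of_closed {x y : Fin n → Bool} {i : Fin n}
    (hyi : y i = false) (hxp : x (i - 1) = false) (hyp : y (i - 1) = true)
    (huniq : ∀ j, x j = true → y j = false → j = i) {SA SB : Finset (Vertex n)}
    (hgA : ∀ u ∈ SA, stepB y u ∈ SB) (hfB : ∀ v ∈ SB, stepA x v ∈ SA)
    (hpA : ∀ u ∈ SA, ∃ v ∈ SB, stepA x v = u) (hpB : ∀ v ∈ SB, ∃ u ∈ SA, stepB y u = v)
    (hv₀ : (i, Label.l0) ∉ SB) : SA = ∅ := by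
  -- An in-edge of `(j, 0)` in the graph of `B` forces `y j = 0`; then `x j = 1` would mean `j = i`,
  -- which is excluded. So no back edge leaves `SB`.
  have hB0 : ∀ j, (j, Label.l0) ∈ SB → y j = false ∧ x j = false := by
    intro j hj
    have hy : y j = false := by
      obtain ⟨⟨k, z⟩, -, hk⟩ := hpB _ hj
      cases z <;> simp [stepB] at hk <;> obtain ⟨rfl, hk⟩ := hk <;> simpa using hk
    refine ⟨hy, ?_⟩
    by_contra hx
    rw [Bool.not_eq_false] at hx
    exact hv₀ (huniq j hx hy ▸ hj)
  -- `P j` says that an entry vertex of index `j`, one with label other than `1`, is occupied.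
  -- Without back edges occupancy passes from `j` to `j + 1`, hence around the ring to `i - 1`,
  -- where each case contradicts the padding or leads to `(i, 0)`.
  set P : Fin n → Prop := fun j =>
    (∃ z, z ≠ Label.l1 ∧ (j, z) ∈ SA) ∨ (∃ z, z ≠ Label.l1 ∧ (j, z) ∈ SB) with hP
  have hA1 : ∀ j, (j, Label.l1) ∈ SA → P (j + 1) := fun j hj =>
    Or.inr ⟨_, by split_ifs <;> simp, hgA _ hj⟩
  have hB1 : ∀ j, (j, Label.l1) ∈ SB → P (j + 1) := fun j hj =>
    Or.inl ⟨_, by split_ifs <;> simp, hfB _ hj⟩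
  have hstep : ∀ j, P j → P (j + 1) := by
    rintro j (⟨z, hz, hj⟩ | ⟨z, hz, hj⟩)
    · cases z
      · exact Or.inr ⟨_, by split_ifs <;> simp, hgA _ hj⟩
      · exact absurd rfl hz
      · exact hB1 j (hgA _ hj)
      · exact hB1 j (hgA _ hj)
    · cases z
      · have h := hfB _ hj
        simp only [stepA, (hB0 j hj).2] at h
        exact Or.inl ⟨_, by split_ifs <;> simp, h⟩
      · exact absurd rfl hz
      · exact hA1 j (hfB _ hj)
      · exact hA1 j (hfB _ hj)
  by_contra hne
  obtain ⟨⟨j, z⟩, hj⟩ := Finset.nonempty_iff_ne_empty.2 hne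
  obtain ⟨k, hk⟩ : ∃ k, P k := by
    by_cases hz : z = .l1
    · exact ⟨_, hA1 j (hz ▸ hj)⟩
    · exact ⟨j, Or.inl ⟨z, hz, hj⟩⟩
  have hall : ∀ m : ℕ, P (k + (m : Fin n)) := by
    intro m
    induction m with
    | zero => simpa using hk
    | succ m ih => rw [Nat.cast_succ, ← add_assoc]; exact hstep _ ih
  have hp : P (i - 1) := by
    have := hall (i - 1 - k : Fin n).val
    rwa [Fin.cast_val_eq_self, add_sub_cancel] at this
  have hA1' : (i - 1, Label.l1) ∉ SA := fun h => hv₀ (by simpa [stepB, hyi] using hgA _ h)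
  rcases hp with ⟨z, hz, h⟩ | ⟨z, hz, h⟩
  · cases z
    · exact hv₀ (by simpa [stepB, hyi] using hgA _ h)
    · exact hz rfl
    all_goals
      obtain ⟨v, -, hv⟩ := hpA _ h
      have := bit_of_stepA_eq_mid hv (by simp)
      simp [hxp] at this
  · cases z
    · simp [(hB0 _ h).1] at hyp
    · exact hz rfl
    · exact hA1' (hfB _ h)
    · exact hA1' (hfB _ h)

/-- Almost optimal responses concentrate on the 2-cycle at `i`. -/
theorem three_quarters_le_of_isApproxBestResponse {ε : ℝ}
    (hε : ε ≤ 1 / (16 * (Fintype.card (Vertex n) : ℝ) ^ 2)) {x y : Fin n → Bool} {i : Fin n}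
    (hxi : x i = true) (hyi : y i = false) (hxp : x (i - 1) = false) (hyp : y (i - 1) = true)
    (huniq : ∀ j, x j = true → y j = false → j = i) {a b : stdSimplex ℝ (Vertex n)}
    (ha : IsApproxBestResponse ε (stepA x) a b) (hb : IsApproxBestResponse ε (stepB y) b a) :
    3 / 4 ≤ a (i - 1, Label.l0) := by
  set d := 1 / (4 * (Fintype.card (Vertex n) : ℝ)) with hd
  have : Nonempty (Vertex n) := ⟨(0, .l0)⟩
  have hN : (0 : ℝ) < Fintype.card (Vertex n) := by exact_mod_cast Fintype.card_pos
  obtain ⟨h1, h2, h3, h4⟩ := closed_erase_of_two_cycle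
    (f := stepA x) (g := stepB y) (SA := Finset.univ.filter (fun u => d ≤ a u))
    (SB := Finset.univ.filter (fun v => d ≤ b v)) (u₀ := (i - 1, .l0)) (v₀ := (i, .l0))
    (fun u hu => by
      obtain ⟨v, hv, hbv⟩ := ha.exists_preimage hε (card_stepA_fiber_le x) (Finset.mem_filter.1 hu).2
      exact ⟨v, Finset.mem_filter.2 ⟨Finset.mem_univ _, hbv⟩, hv⟩)
    (fun v hv => by
      obtain ⟨u, hu, hau⟩ := hb.exists_preimage hε (card_stepB_fiber_le y) (Finset.mem_filter.1 hv).2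
      exact ⟨u, Finset.mem_filter.2 ⟨Finset.mem_univ _, hau⟩, hu⟩)
    (by simp [stepA, hxi, hxp, bitLabel]) (by simp [stepB, hyi])
  have hempty := eq_empty_of_closed hyi hxp hyp huniq h1 h2 h3 h4 (by simp)
  -- Off the 2-cycle nothing is heavy, so at most `N * d = 1/4` of the mass is lost.
  have hlt : ∀ u ∈ Finset.univ.erase ((i - 1, Label.l0) : Vertex n), a u ≤ d := by
    intro u hu
    by_contra hlt
    have : u ∈ (Finset.univ.filter (fun u => d ≤ a u)).erase (i - 1, Label.l0) :=
      Finset.mem_erase.2 ⟨Finset.ne_of_mem_erase hu, Finset.mem_filter.2 ⟨Finset.mem_univ _, (not_le.1 hlt).le⟩⟩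
    rw [hempty] at this
    exact absurd this (Finset.notMem_empty u)
  have hs : ∑ u, a u = 1 := a.2.2
  rw [← Finset.add_sum_erase _ _ (Finset.mem_univ ((i - 1, Label.l0) : Vertex n))] at hs
  have hle := Finset.sum_le_sum hlt
  rw [Finset.sum_const, nsmul_eq_mul] at hle
  have hc : ((Finset.univ.erase ((i - 1, Label.l0) : Vertex n)).card : ℝ) * d ≤
      Fintype.card (Vertex n) * d :=
    mul_le_mul_of_nonneg_right (by exact_mod_cast Finset.card_le_univ _) (by positivity)
  have hd4 : (Fintype.card (Vertex n) : ℝ) * d = 1 / 4 := by rw [hd]; field_simp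
  linarith

end TwoCycle

/-! ### From set intersection to the Bayesian game. -/

section Reduction

theorem card_vertex (n : ℕ) : Fintype.card (Vertex n) = 4 * n := by
  rw [Fintype.card_prod, Fintype.card_fin, mul_comm]
  rfl

/-- Under the diagonal prior a type knows the opponent's type, so the conditional utility is that of
a single game; one out-edge per vertex leaves one term for each opposing action. -/
theorem isApproxBestResponse_of_isApproxBayesianNash {T n : ℕ} [NeZero T] [NeZero n] {ε : ℝ}
    {x y : Fin (T * n) → Bool} {a b : Fin T → MixedStrategy (Vertex n)}
    (h : IsApproxBayesianNash ε (diagonalPrior T) (bayesianTwoCycleUtilityA x)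
      (bayesianTwoCycleUtilityB y) a b) (t : Fin T) :
    IsApproxBestResponse ε (stepA (block x t)) (a t) (b t) ∧
      IsApproxBestResponse ε (stepB (block y t)) (b t) (a t) := by
  classical
  have hT : (T : ℝ) ≠ 0 := Nat.cast_ne_zero.2 (NeZero.ne T)
  have hφ : ∀ p : Fin T × Fin T, diagonalPrior T p = if p.1 = p.2 then 1 / (T : ℝ) else 0 :=
    fun _ => rfl
  have hA : ∀ a' : MixedStrategy (Vertex n), expectedUtilityA (diagonalPrior T)
      (bayesianTwoCycleUtilityA x) t a' b = ∑ v, b t v * a' (stepA (block x t) v) := by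
    intro a'
    unfold expectedUtilityA
    rw [Finset.sum_eq_single t]
    · simp only [hφ, Finset.sum_ite_eq, Finset.mem_univ, if_true, div_self (one_div_ne_zero hT),
        one_mul]
      rw [Finset.sum_comm]
      refine Finset.sum_congr rfl fun v _ => ?_
      rw [Finset.sum_eq_single (stepA (block x t) v)]
      · simp [bayesianTwoCycleUtilityA, twoCycleUtilityA, edgeA_iff, mul_comm]
      · intro u _ hu
        simp [bayesianTwoCycleUtilityA, twoCycleUtilityA, edgeA_iff, Ne.symm hu]
      · simp
    · intro t' _ ht'
      simp [hφ, Ne.symm ht']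
    · simp
  have hB : ∀ b' : MixedStrategy (Vertex n), expectedUtilityB (diagonalPrior T)
      (bayesianTwoCycleUtilityB y) t a b' = ∑ u, a t u * b' (stepB (block y t) u) := by
    intro b'
    unfold expectedUtilityB
    rw [Finset.sum_eq_single t]
    · simp only [hφ, Finset.sum_ite_eq', Finset.mem_univ, if_true, div_self (one_div_ne_zero hT),
        one_mul]
      refine Finset.sum_congr rfl fun u _ => ?_
      rw [Finset.sum_eq_single (stepB (block y t) u)]
      · simp [bayesianTwoCycleUtilityB, twoCycleUtilityB, edgeB_iff]
      · intro v _ hv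
        simp [bayesianTwoCycleUtilityB, twoCycleUtilityB, edgeB_iff, Ne.symm hv]
      · simp
    · intro t' _ ht'
      simp [hφ, ht']
    · simp
  refine ⟨fun a' => ?_, fun b' => ?_⟩
  · have := h.1 t a'
    rwa [hA, hA] at this
  · have := h.2 t b'
    rwa [hB, hB] at this

/-- The positions of the bits that encode a set: the odd positions of every block. -/
abbrev OddPosition (T n : ℕ) : Type := Fin T × {p : Fin n // Odd p.val}

theorem le_three_mul_card_odd {n : ℕ} (hn : 3 ≤ n) :
    n ≤ 3 * Fintype.card {p : Fin n // Odd p.val} := by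
  have h := Fintype.card_le_of_injective
    (fun k : Fin (n / 2) => (⟨⟨2 * k.val + 1, by have := k.2; omega⟩, by simp⟩ :
      {p : Fin n // Odd p.val})) (fun k l hkl => by
        simp only [Subtype.mk.injEq, Fin.mk.injEq] at hkl
        exact Fin.ext (by omega))
  rw [Fintype.card_fin] at h
  omega

open Classical in
/-- The string of player `A` that encodes the set `S`: zeros at even positions. -/
noncomputable def encodeA {T n : ℕ} (S : Finset (OddPosition T n)) (k : Fin (T * n)) : Bool :=
  decide (∃ q ∈ S, finProdFinEquiv (q.1, q.2.val) = k)

open Classical in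
/-- The string of player `B` that encodes the set `S`: ones at even positions, and the complement
of `S` at the odd positions. -/
noncomputable def encodeB {T n : ℕ} (S : Finset (OddPosition T n)) (k : Fin (T * n)) : Bool :=
  decide (¬ ∃ q ∈ S, finProdFinEquiv (q.1, q.2.val) = k)

theorem block_encodeA_eq_true {T n : ℕ} (S : Finset (OddPosition T n)) (t : Fin T) (p : Fin n) :
    block (encodeA S) t p = true ↔ ∃ h : Odd p.val, (t, ⟨p, h⟩) ∈ S := by
  unfold block encodeA
  rw [decide_eq_true_iff]
  constructor
  · rintro ⟨⟨t', p', hp'⟩, hS, h⟩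
    obtain ⟨rfl, rfl⟩ := Prod.mk.inj (finProdFinEquiv.injective h)
    exact ⟨hp', hS⟩
  · rintro ⟨h, hS⟩
    exact ⟨_, hS, rfl⟩

theorem block_encodeB_eq_false {T n : ℕ} (S : Finset (OddPosition T n)) (t : Fin T) (p : Fin n) :
    block (encodeB S) t p = false ↔ ∃ h : Odd p.val, (t, ⟨p, h⟩) ∈ S := by
  rw [← block_encodeA_eq_true]
  unfold block encodeA encodeB
  simp

open Classical in
/-- The index named by the strategies of player `A`: one whose 2-cycle is played by player `A` most
of the time. -/
noncomputable def namedIndex {T n : ℕ} [NeZero n] (a : Fin T → MixedStrategy (Vertex n)) :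
    Option (OddPosition T n) :=
  if h : ∃ q : OddPosition T n, 3 / 4 ≤ a q.1 (q.2.val - 1, Label.l0) then some h.choose else none

theorem existsUnique_encode_gt {T n : ℕ} {S S' : Finset (OddPosition T n)} {q : OddPosition T n}
    (h : S ∩ S' = {q}) : ∃! k, encodeA S k > encodeB S' k := by
  have hiff : ∀ t p, encodeA S (finProdFinEquiv (t, p)) > encodeB S' (finProdFinEquiv (t, p)) ↔
      (t, p) = (q.1, q.2.val) := by
    intro t p
    change block (encodeA S) t p > block (encodeB S') t p ↔ _
    rw [gt_iff_lt, Bool.lt_iff, block_encodeB_eq_false, block_encodeA_eq_true]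
    constructor
    · rintro ⟨⟨h1, h2⟩, h3, h4⟩
      have : (t, ⟨p, h1⟩) ∈ S ∩ S' := Finset.mem_inter.2 ⟨h4, h2⟩
      rw [h, Finset.mem_singleton] at this
      rw [← this]
    · intro hq
      obtain ⟨rfl, rfl⟩ := Prod.mk.inj hq
      have : q ∈ S ∩ S' := h ▸ Finset.mem_singleton_self q
      exact ⟨⟨q.2.2, (Finset.mem_inter.1 this).2⟩, q.2.2, (Finset.mem_inter.1 this).1⟩
  refine ⟨finProdFinEquiv (q.1, q.2.val), (hiff _ _).2 rfl, fun k hk => ?_⟩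
  obtain ⟨⟨t, p⟩, rfl⟩ := finProdFinEquiv.surjective k
  rw [(hiff t p).1 hk]

/-- The strategies of player `A` in an approximate equilibrium name the common element. -/
theorem namedIndex_eq {T n : ℕ} [NeZero T] [NeZero n] (hn : 3 ≤ n) {ε : ℝ}
    (hε : ε ≤ 1 / (16 * ((4 * n : ℕ) : ℝ) ^ 2)) {S S' : Finset (OddPosition T n)}
    {q : OddPosition T n} (hq : S ∩ S' = {q}) {a b : Fin T → MixedStrategy (Vertex n)}
    (h : IsApproxBayesianNash ε (diagonalPrior T) (bayesianTwoCycleUtilityA (encodeA S))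
      (bayesianTwoCycleUtilityB (encodeB S')) a b) : namedIndex a = some q := by
  classical
  have hmem : ∀ q', q' ∈ S → q' ∈ S' → q' = q := fun q' h1 h2 =>
    Finset.mem_singleton.1 (hq ▸ Finset.mem_inter.2 ⟨h1, h2⟩)
  have hqS : q ∈ S ∩ S' := hq ▸ Finset.mem_singleton_self q
  obtain ⟨h1, h2⟩ := Finset.mem_inter.1 hqS
  have hbits : ∀ t p, block (encodeA S) t p = true → block (encodeB S') t p = false →
      ∃ h : Odd p.val, (t, ⟨p, h⟩) = q := by
    intro t p hA hB
    obtain ⟨ho, hS⟩ := (block_encodeA_eq_true S t p).1 hA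
    obtain ⟨_, hS'⟩ := (block_encodeB_eq_false S' t p).1 hB
    exact ⟨ho, hmem _ hS hS'⟩
  have hε16 : ε ≤ 1 / 16 := by
    refine hε.trans (one_div_le_one_div_of_le (by norm_num) ?_)
    have : (1 : ℝ) ≤ ((4 * n : ℕ) : ℝ) := by exact_mod_cast (by omega : 1 ≤ 4 * n)
    nlinarith
  have hex : 3 / 4 ≤ a q.1 (q.2.val - 1, Label.l0) := by
    obtain ⟨hA, hB⟩ := isApproxBestResponse_of_isApproxBayesianNash h q.1
    have hodd : Odd q.2.val.val := q.2.2
    -- An odd position is nonzero, so subtracting `1` does not wrap around and lands on an even,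
    -- padded position.
    have hpad : ¬ Odd (q.2.val - 1 : Fin n).val := by
      rw [Fin.val_sub_one_of_ne_zero, Nat.not_odd_iff_even]
      · exact Nat.Odd.sub_odd hodd odd_one
      · intro h0
        rw [h0] at hodd
        simp at hodd
    refine three_quarters_le_of_isApproxBestResponse (by rwa [card_vertex])
      ((block_encodeA_eq_true S _ _).2 ⟨q.2.2, h1⟩)
      ((block_encodeB_eq_false S' _ _).2 ⟨q.2.2, h2⟩) ?_ ?_ ?_ hA hB
    · rw [← Bool.not_eq_true, block_encodeA_eq_true]
      exact fun h => hpad h.1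
    · rw [← Bool.not_eq_false, block_encodeB_eq_false]
      exact fun h => hpad h.1
    · intro p hp hp'
      obtain ⟨ho, hpq⟩ := hbits _ p hp hp'
      rw [← hpq]
  have hx : ∃ q : OddPosition T n, 3 / 4 ≤ a q.1 (q.2.val - 1, Label.l0) := ⟨q, hex⟩
  rw [namedIndex, dif_pos hx]
  congr 1
  -- The chosen index may lie in another block, so soundness is needed: its 2-cycle forces `x > y`
  -- there, which happens only at `q`.
  have hc := hx.choose_spec
  set q' := hx.choose
  obtain ⟨hA, hB⟩ := isApproxBestResponse_of_isApproxBayesianNash h q'.1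
  obtain ⟨hb1, hb2⟩ := bits_of_two_cycle hn (apply_apply_eq_of_three_quarters_le hε16 hA hB hc)
  rw [sub_add_cancel] at hb1 hb2
  obtain ⟨_, h3⟩ := hbits _ _ hb1 hb2
  exact h3

theorem FindsApproxBayesianNash.findsUniqueCommon {T n : ℕ} [NeZero T] [NeZero n] (hn : 3 ≤ n)
    {ε : ℝ} (hε : ε ≤ 1 / (16 * ((4 * n : ℕ) : ℝ) ^ 2))
    {π : RandomizedProtocol.{u} (Fin T → Vertex n → Vertex n → unitInterval)
      (Fin T → Vertex n → Vertex n → unitInterval)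
      (Fin T → MixedStrategy (Vertex n)) (Fin T → MixedStrategy (Vertex n))}
    (h : FindsApproxBayesianNash T n ε (1 / 3) π) :
    π.FindsUniqueCommon namedIndex (fun S => bayesianTwoCycleUtilityA (encodeA S))
      (fun S => bayesianTwoCycleUtilityB (encodeB S)) := by
  intro S S' q hq
  refine le_trans (measure_mono ?_) (h _ _ ⟨_, _, existsUnique_encode_gt hq, rfl, rfl⟩)
  intro ω hω hnash
  have hqS : q ∈ S ∩ S' := hq ▸ Finset.mem_singleton_self q
  obtain ⟨h1, h2⟩ := Finset.mem_inter.1 hqS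
  exact hω ⟨q, namedIndex_eq hn hε hq hnash, h1, h2⟩

end Reduction

theorem theorem5 :
    ∃ c : ℝ, 0 < c ∧
      ∀ (N n T : ℕ) [NeZero n] [NeZero T], N = 4 * n → 12 ≤ N → 2 ≤ T →
        ∀ ε : ℝ, ε ≤ 1 / (16 * (N : ℝ) ^ 2) →
          ∀ π : RandomizedProtocol.{u} (Fin T → Vertex n → Vertex n → unitInterval)
              (Fin T → Vertex n → Vertex n → unitInterval)
              (Fin T → MixedStrategy (Vertex n)) (Fin T → MixedStrategy (Vertex n)),
            FindsApproxBayesianNash T n ε (1 / 3) π →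
              ∀ C : ℕ, π.CostAtMost C → c * ((N : ℝ) * (T : ℝ)) ≤ (C : ℝ) := by
  obtain ⟨c, hc, hbound⟩ := exists_linear_bound_findsUniqueCommon.{u}
  -- At least a third of the positions in a block are odd, and `N = 4 n`, so `N * T` is at most `12`
  -- times the ground set.
  refine ⟨c / 12, by positivity, ?_⟩
  rintro N n T _ _ rfl hN hT ε hε π hπ C hC
  have hn : 3 ≤ n := by omega
  have hnt : Nontrivial (OddPosition T n) := by
    have : Nontrivial (Fin T) := Fin.nontrivial_iff_two_le.2 hT
    have : Nonempty {p : Fin n // Odd p.val} := ⟨⟨⟨1, by omega⟩, odd_one⟩⟩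
    infer_instance
  have h := hbound π _ _ _ (hπ.findsUniqueCommon hn hε) C hC
  have hcard : 4 * n * T ≤ 12 * Fintype.card (OddPosition T n) := by
    rw [Fintype.card_prod, Fintype.card_fin]
    nlinarith [Nat.mul_le_mul_left T (le_three_mul_card_odd hn)]
  have hcard' : ((4 * n : ℕ) : ℝ) * T ≤ 12 * Fintype.card (OddPosition T n) := by
    exact_mod_cast hcard
  calc c / 12 * (((4 * n : ℕ) : ℝ) * T) ≤ c / 12 * (12 * Fintype.card (OddPosition T n)) :=
        mul_le_mul_of_nonneg_left hcard' (by positivity)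
    _ = c * Fintype.card (OddPosition T n) := by ring
    _ ≤ C := h
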